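/- Let $g\ge 0$ be an integer. Let $\mathbb H_g$ be the Siegel space of symmetric complex $g\times g$ matrices with positive definite imaginary part, on which $M=\begin{pmatrix}a&b\\c&d\end{pmatrix}\in\operatorname{Sp}(2g,\mathbb Z)$ acts by $M(\tau)=(a\tau+b)(c\tau+d)^{-1}$, and let $\mathsf A_g=\operatorname{Sp}(2g,\mathbb Z)\backslash\mathbb H_g$, with projection $\pi:\mathbb H_g\to\mathsf A_g$. For $u\in U:=\frac12\mathbb Z^g/\mathbb Z^g$ and $\tau\in\mathbb H_g$ put $$\theta_u(0;\tau)=\sum_{m\in\mathbb Z^g}\exp\bigl(2\pi\sqrt{-1}\,(m+u)^t\tau(m+u)\bigr),$$ which depends only on the class of $u$ modulo $\mathbb Z^g$. Then for every $\tau\in\mathbb H_g$ the numbers $\theta_u(0;\tau)$, $u\in U$, are not all zero, and the resulting map $$\Theta:\mathbb H_g\to\mathbb P^{2^g-1},\qquad \tau\mapsto[\theta_u(0;\tau)]_{u\in U},$$ is holomorphic. Let $\omega_{FS}$ be the Fubini–Study form on $\mathbb P^{2^g-1}$, given in homogeneous coordinates $Z$ by $\omega_{FS}=\frac{\sqrt{-1}}2\,\partial\bar\partial\log|Z|^2$.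 The form $\Theta^*\omega_{FS}$ is invariant under $\operatorname{Sp}(2g,\mathbb Z)$, i.e. $M^*(\Theta^*\omega_{FS})=\Theta^*\omega_{FS}$ for every $M\in\operatorname{Sp}(2g,\mathbb Z)$, and it descends to $\mathsf A_g$: there is a unique smooth $(1,1)$-form $\eta$ on the orbifold $\mathsf A_g$ with $\pi^*\eta=\Theta^*\omega_{FS}$. (A smooth $(1,1)$-form on the orbifold $\mathsf A_g$ assigns to each $x\in\mathsf A_g$ a family of 2-forms on the tangent spaces $T_\tau\mathbb H_g$, $\tau\in\pi^{-1}(x)$, which correspond to each other under the differentials of the elements of $\operatorname{Sp}(2g,\mathbb Z)$, such that the form it induces on $\mathbb H_g$ is smooth and of type $(1,1)$.) -/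

import Mathlib

open scoped ContDiff Matrix

noncomputable section

namespace ThetaFS

/-! ## Differential forms on complex vector spaces -/

section Forms

variable {E V : Type*} [NormedAddCommGroup E] [NormedSpace ℂ E]
  [NormedAddCommGroup V] [NormedSpace ℂ V]

/-- Complex valued alternating real 2-forms on (the real vector space underlying) `E`. -/
abbrev TwoForm (E : Type*) [NormedAddCommGroup E] [NormedSpace ℂ E] : Type _ :=
  E [⋀^Fin 2]→L[ℝ] ℂ

/-- The 1-form `∂̄ f`, i.e. the complex antilinear part of `df`:
`(∂̄ f)ₓ(v) = (dfₓ(v) + i dfₓ(i v)) / 2`. -/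
def delbar (f : E → ℂ) (x : E) : E [⋀^Fin 1]→L[ℝ] ℂ :=
  ContinuousAlternatingMap.ofSubsingleton ℝ E ℂ (0 : Fin 1)
    ((1 / 2 : ℂ) • (fderiv ℝ f x + Complex.I •
      (fderiv ℝ f x).comp ((Complex.I • ContinuousLinearMap.id ℂ E).restrictScalars ℝ)))

/-- The 2-form `∂∂̄ f`. It is computed as `d(∂̄ f)`, which is the same since `∂̄∂̄ f = 0`. -/
def deldelbar (f : E → ℂ) : E → TwoForm E :=
  extDeriv (delbar f)

/-- The pullback at `x` of a 2-form on `V` by a map `F : E → V` which is holomorphic near `x`. -/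
def pullback (F : E → V) (η : V → TwoForm V) (x : E) : TwoForm E :=
  (η (F x)).compContinuousLinearMap ((fderiv ℂ F x).restrictScalars ℝ)

end Forms

/-! ## The Fubini–Study form -/

section FubiniStudy

variable {ι : Type*} [Fintype ι] {E : Type*} [NormedAddCommGroup E] [NormedSpace ℂ E]

/-- The Fubini–Study form `(i/2) ∂∂̄ log |Z|²` in the homogeneous coordinates
`Z = (Z_k)` of the projective space `ℙ(ℂ^ι)`, where `|Z|² = ∑ |Z_k|²`. -/
def fubiniStudy (ι : Type*) [Fintype ι] (Z : EuclideanSpace ℂ ι) :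
    TwoForm (EuclideanSpace ℂ ι) :=
  (Complex.I / 2) • deldelbar (fun Y => ((Real.log (‖Y‖ ^ 2) : ℝ) : ℂ)) Z

/-- `F` is a holomorphic local expression of `Φ : S → ℙ(ℂ^ι)` in homogeneous coordinates, on the
open set `W ⊆ S`. -/
structure IsHomogeneousLift {S : Set E} (Φ : S → Projectivization ℂ (EuclideanSpace ℂ ι))
    (W : Set E) (F : E → EuclideanSpace ℂ ι) : Prop where
  isOpen : IsOpen W
  subset : W ⊆ S
  differentiableOn : DifferentiableOn ℂ F W
  lift : ∀ x : S, (x : E) ∈ W → ∃ hx : F x ≠ 0, Φ x = Projectivization.mk ℂ (F x) hx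

/-- `Φ : S → ℙ(ℂ^ι)` is holomorphic (`S` an open set of a complex vector space): locally it is
given by holomorphic homogeneous coordinates. -/
def IsHolomorphicToProj {S : Set E}
    (Φ : S → Projectivization ℂ (EuclideanSpace ℂ ι)) : Prop :=
  ∀ x : S, ∃ (W : Set E) (F : E → EuclideanSpace ℂ ι), (x : E) ∈ W ∧ IsHomogeneousLift Φ W F

/-- `Ω = Φ^* ω_FS` for the holomorphic map `Φ : S → ℙ(ℂ^ι)`: for every expression `F` of `Φ` in
homogeneous coordinates on an open subset, `Ω` is there the pullback by `F` of
`(i/2) ∂∂̄ log |Z|²`. -/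
def IsFubiniStudyPullback {S : Set E} (Φ : S → Projectivization ℂ (EuclideanSpace ℂ ι))
    (Ω : S → TwoForm E) : Prop :=
  IsHolomorphicToProj Φ ∧
    ∀ (W : Set E) (F : E → EuclideanSpace ℂ ι), IsHomogeneousLift Φ W F →
      ∀ x : S, (x : E) ∈ W → Ω x = pullback F (fubiniStudy ι) x

end FubiniStudy

/-! ## The Siegel space -/

section SymMat

attribute [local instance] Matrix.normedAddCommGroup Matrix.normedSpace

/-- The complex vector space of symmetric complex `g × g` matrices, as a subspace. -/
def symSubmodule (g : ℕ) : Submodule ℂ (Matrix (Fin g) (Fin g) ℂ) where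
  carrier := {A | A.IsSymm}
  add_mem' hA hB := hA.add hB
  zero_mem' := Matrix.isSymm_zero
  smul_mem' c _ hA := hA.smul c

/-- The complex vector space of symmetric complex `g × g` matrices. -/
def SymMat (g : ℕ) : Type := symSubmodule g

/-- The norm is the maximum of the absolute values of the entries (all norms are equivalent). -/
instance (g : ℕ) : NormedAddCommGroup (SymMat g) :=
  inferInstanceAs (NormedAddCommGroup (symSubmodule g))

instance (g : ℕ) : NormedSpace ℂ (SymMat g) :=
  inferInstanceAs (NormedSpace ℂ (symSubmodule g))

instance (g : ℕ) : FiniteDimensional ℂ (SymMat g) :=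
  inferInstanceAs (FiniteDimensional ℂ (symSubmodule g))

end SymMat

/-- The matrix underlying a symmetric matrix. -/
def SymMat.toMatrix {g : ℕ} (τ : SymMat g) : Matrix (Fin g) (Fin g) ℂ := τ.val

/-- Conditions for a complex matrix to be in the Siegel space: symmetric, with positive definite
imaginary part. -/
def IsSiegel {g : ℕ} (τ : Matrix (Fin g) (Fin g) ℂ) : Prop :=
  τ.IsSymm ∧ (τ.map Complex.im).PosDef

/-- The Siegel space `ℍ_g`, as a subset of the space of symmetric matrices. -/
def siegelSet (g : ℕ) : Set (SymMat g) := {τ | IsSiegel τ.toMatrix}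

/-- The Siegel space `ℍ_g`. -/
abbrev SiegelSpace (g : ℕ) : Type := siegelSet g

/-- `Sp(2g, ℤ)`. -/
abbrev Sp (g : ℕ) : Type := Matrix.symplecticGroup (Fin g) ℤ

/-- `a τ + b` for `M = (a b; c d)`. -/
def num {g : ℕ} (M : Sp g) (τ : Matrix (Fin g) (Fin g) ℂ) : Matrix (Fin g) (Fin g) ℂ :=
  M.val.toBlocks₁₁.map (Int.cast : ℤ → ℂ) * τ + M.val.toBlocks₁₂.map (Int.cast : ℤ → ℂ)

/-- `c τ + d` for `M = (a b; c d)`. -/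
def den {g : ℕ} (M : Sp g) (τ : Matrix (Fin g) (Fin g) ℂ) : Matrix (Fin g) (Fin g) ℂ :=
  M.val.toBlocks₂₁.map (Int.cast : ℤ → ℂ) * τ + M.val.toBlocks₂₂.map (Int.cast : ℤ → ℂ)

section Action

variable {g : ℕ}

theorem blocks_rel (M : Sp g) :
    (M.val.toBlocks₁₁)ᵀ * M.val.toBlocks₂₁ = (M.val.toBlocks₂₁)ᵀ * M.val.toBlocks₁₁ ∧
    (M.val.toBlocks₁₂)ᵀ * M.val.toBlocks₂₂ = (M.val.toBlocks₂₂)ᵀ * M.val.toBlocks₁₂ ∧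
    (M.val.toBlocks₁₁)ᵀ * M.val.toBlocks₂₂ = (M.val.toBlocks₂₁)ᵀ * M.val.toBlocks₁₂ + 1 ∧
    (M.val.toBlocks₂₂)ᵀ * M.val.toBlocks₁₁ = (M.val.toBlocks₁₂)ᵀ * M.val.toBlocks₂₁ + 1 := by
  have h := SymplecticGroup.mem_iff'.mp M.2
  rw [← Matrix.fromBlocks_toBlocks M.val, Matrix.J, Matrix.fromBlocks_transpose,
    Matrix.fromBlocks_multiply, Matrix.fromBlocks_multiply, Matrix.fromBlocks_inj] at h
  simp only [Matrix.mul_zero, Matrix.mul_one, Matrix.mul_neg, zero_add, add_zero,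
    Matrix.neg_mul] at h
  obtain ⟨h1, h2, h3, h4⟩ := h
  refine ⟨?_, ?_, ?_, ?_⟩
  · rw [← sub_eq_zero, ← neg_eq_zero, ← h1]; abel
  · rw [← sub_eq_zero, ← neg_eq_zero, ← h4]; abel
  · rw [← sub_eq_zero, ← neg_eq_zero]
    have := sub_eq_zero.mpr h2
    rw [← this]; abel
  · rw [← sub_eq_zero]
    have := sub_eq_zero.mpr h3
    rw [← this]; abel

theorem num_den_rel (M : Sp g) (X τ : Matrix (Fin g) (Fin g) ℂ) :
    (X * (M.val.toBlocks₂₁.map (Int.cast : ℤ → ℂ))ᵀ +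
        (M.val.toBlocks₂₂.map (Int.cast : ℤ → ℂ))ᵀ) * num M τ =
      (X * (M.val.toBlocks₁₁.map (Int.cast : ℤ → ℂ))ᵀ +
        (M.val.toBlocks₁₂.map (Int.cast : ℤ → ℂ))ᵀ) * den M τ + (τ - X) := by
  obtain ⟨h1, h2, h3, h4⟩ := blocks_rel M
  have c1 := congrArg (fun A : Matrix (Fin g) (Fin g) ℤ => A.map (Int.castRingHom ℂ)) h1
  have c2 := congrArg (fun A : Matrix (Fin g) (Fin g) ℤ => A.map (Int.castRingHom ℂ)) h2
  have c3 := congrArg (fun A : Matrix (Fin g) (Fin g) ℤ => A.map (Int.castRingHom ℂ)) h3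
  have c4 := congrArg (fun A : Matrix (Fin g) (Fin g) ℤ => A.map (Int.castRingHom ℂ)) h4
  simp only [Matrix.map_mul, Matrix.transpose_map, Matrix.map_add _ (map_add _),
    Matrix.map_one _ (map_zero _) (map_one _)] at c1 c2 c3 c4
  simp only [Int.coe_castRingHom] at c1 c2 c3 c4
  unfold num den
  simp only [← Matrix.transpose_map] at *
  generalize M.val.toBlocks₁₁ᵀ.map (Int.cast : ℤ → ℂ) = A' at *
  generalize M.val.toBlocks₁₂ᵀ.map (Int.cast : ℤ → ℂ) = B' at *
  generalize M.val.toBlocks₂₁ᵀ.map (Int.cast : ℤ → ℂ) = C' at *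
  generalize M.val.toBlocks₂₂ᵀ.map (Int.cast : ℤ → ℂ) = D' at *
  generalize M.val.toBlocks₁₁.map (Int.cast : ℤ → ℂ) = A at *
  generalize M.val.toBlocks₁₂.map (Int.cast : ℤ → ℂ) = B at *
  generalize M.val.toBlocks₂₁.map (Int.cast : ℤ → ℂ) = C at *
  generalize M.val.toBlocks₂₂.map (Int.cast : ℤ → ℂ) = D at *
  have e1 : (X * C' + D') * (A * τ + B) =
      X * (C' * A) * τ + X * (C' * B) + (D' * A) * τ + D' * B := by noncomm_ring
  have e2 : (X * A' + B') * (C * τ + D) =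
      X * (A' * C) * τ + X * (A' * D) + (B' * C) * τ + B' * D := by noncomm_ring
  rw [e1, e2, c1, c2, c3, c4]
  noncomm_ring

theorem den_conjTranspose (M : Sp g) (τ : Matrix (Fin g) (Fin g) ℂ) :
    (den M τ)ᴴ = τᴴ * (M.val.toBlocks₂₁.map (Int.cast : ℤ → ℂ))ᵀ +
        (M.val.toBlocks₂₂.map (Int.cast : ℤ → ℂ))ᵀ := by
  have h : ∀ A : Matrix (Fin g) (Fin g) ℤ,
      (A.map (Int.cast : ℤ → ℂ))ᴴ = (A.map (Int.cast : ℤ → ℂ))ᵀ := by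
    intro A; ext i j; simp [Matrix.conjTranspose_apply]
  simp [den, h]

theorem num_conjTranspose (M : Sp g) (τ : Matrix (Fin g) (Fin g) ℂ) :
    (num M τ)ᴴ = τᴴ * (M.val.toBlocks₁₁.map (Int.cast : ℤ → ℂ))ᵀ +
        (M.val.toBlocks₁₂.map (Int.cast : ℤ → ℂ))ᵀ := by
  have h : ∀ A : Matrix (Fin g) (Fin g) ℤ,
      (A.map (Int.cast : ℤ → ℂ))ᴴ = (A.map (Int.cast : ℤ → ℂ))ᵀ := by
    intro A; ext i j; simp [Matrix.conjTranspose_apply]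
  simp [num, h]

theorem den_num_herm (M : Sp g) (τ : Matrix (Fin g) (Fin g) ℂ) :
    (den M τ)ᴴ * num M τ = (num M τ)ᴴ * den M τ + (τ - τᴴ) := by
  rw [den_conjTranspose, num_conjTranspose]; exact num_den_rel M τᴴ τ

theorem den_num_symm (M : Sp g) {τ : Matrix (Fin g) (Fin g) ℂ} (hτ : τ.IsSymm) :
    (den M τ)ᵀ * num M τ = (num M τ)ᵀ * den M τ := by
  have h := num_den_rel M τ τ
  rw [sub_self, add_zero] at h
  have h1 : (den M τ)ᵀ = τ * (M.val.toBlocks₂₁.map (Int.cast : ℤ → ℂ))ᵀ +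
        (M.val.toBlocks₂₂.map (Int.cast : ℤ → ℂ))ᵀ := by simp [den, hτ.eq]
  have h2 : (num M τ)ᵀ = τ * (M.val.toBlocks₁₁.map (Int.cast : ℤ → ℂ))ᵀ +
        (M.val.toBlocks₁₂.map (Int.cast : ℤ → ℂ))ᵀ := by simp [num, hτ.eq]
  rw [h1, h2]; exact h

theorem im_quadratic (A : Matrix (Fin g) (Fin g) ℂ) (v : Fin g → ℂ) :
    star v ⬝ᵥ A *ᵥ v - star v ⬝ᵥ Aᴴ *ᵥ v =
      2 * Complex.I * ((star v ⬝ᵥ A *ᵥ v).im : ℂ) := by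
  have h : star v ⬝ᵥ Aᴴ *ᵥ v = star (star v ⬝ᵥ A *ᵥ v) := by
    rw [Matrix.star_dotProduct, Matrix.star_mulVec, ← Matrix.dotProduct_mulVec,
      dotProduct_comm, Matrix.conjTranspose_conjTranspose, dotProduct_comm]
  rw [h, Complex.star_def, Complex.sub_conj]
  push_cast; ring

theorem im_dotProduct {τ : Matrix (Fin g) (Fin g) ℂ} (hτ : τ.IsSymm) (v : Fin g → ℂ) :
    (star v ⬝ᵥ τ *ᵥ v).im =
      (fun i => (v i).re) ⬝ᵥ (τ.map Complex.im) *ᵥ (fun i => (v i).re) +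
      (fun i => (v i).im) ⬝ᵥ (τ.map Complex.im) *ᵥ (fun i => (v i).im) := by
  have key : ∑ i, ∑ j, (v i).im * ((τ i j).re * (v j).re) =
      ∑ i, ∑ j, (v i).re * ((τ i j).re * (v j).im) := by
    rw [Finset.sum_comm]
    refine Finset.sum_congr rfl fun i _ => Finset.sum_congr rfl fun j _ => ?_
    rw [hτ.apply i j]; ring
  have e : (star v ⬝ᵥ τ *ᵥ v).im = ∑ i, ∑ j,
      ((v i).re * ((τ i j).im * (v j).re) + (v i).im * ((τ i j).im * (v j).im)
        + ((v i).re * ((τ i j).re * (v j).im) - (v i).im * ((τ i j).re * (v j).re))) := by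
    simp only [dotProduct, Matrix.mulVec, Finset.mul_sum, Complex.im_sum]
    refine Finset.sum_congr rfl fun i _ => Finset.sum_congr rfl fun j _ => ?_
    simp [Complex.mul_im, Complex.mul_re]; ring
  rw [e]
  simp only [Finset.sum_add_distrib, Finset.sum_sub_distrib, key, sub_self, add_zero,
    dotProduct, Matrix.mulVec, Finset.mul_sum, Matrix.map_apply]

theorem isSiegel_iff {τ : Matrix (Fin g) (Fin g) ℂ} :
    IsSiegel τ ↔ τ.IsSymm ∧ ∀ v : Fin g → ℂ, v ≠ 0 → 0 < (star v ⬝ᵥ τ *ᵥ v).im := by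
  refine and_congr_right fun hτ => ⟨fun h v hv => ?_, fun h => ?_⟩
  · rw [im_dotProduct hτ]
    have hnn : ∀ x : Fin g → ℝ, 0 ≤ x ⬝ᵥ (τ.map Complex.im) *ᵥ x := fun x => by
      simpa using h.posSemidef.dotProduct_mulVec_nonneg x
    have hp : ∀ x : Fin g → ℝ, x ≠ 0 → 0 < x ⬝ᵥ (τ.map Complex.im) *ᵥ x := fun x hx => by
      simpa using h.dotProduct_mulVec_pos hx
    by_cases h0 : (fun i => (v i).re) = 0
    · have h1 : (fun i => (v i).im) ≠ 0 := fun h1 => hv (by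
        funext i
        exact Complex.ext (congrFun h0 i) (congrFun h1 i))
      exact add_pos_of_nonneg_of_pos (hnn _) (hp _ h1)
    · exact add_pos_of_pos_of_nonneg (hp _ h0) (hnn _)
  · refine Matrix.PosDef.of_dotProduct_mulVec_pos ?_ fun x hx => ?_
    · ext i j
      simp [Matrix.conjTranspose_apply, hτ.apply i j]
    · have hx' : (fun i => (x i : ℂ)) ≠ 0 := fun h0 => hx (by
        funext i
        exact Complex.ofReal_eq_zero.mp (congrFun h0 i))
      have := h _ hx'
      rw [im_dotProduct hτ] at this
      have hz : (0 : Fin g → ℝ) = fun _ => 0 := rfl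
      simpa [← hz] using this

/-- `c τ + d` is invertible for `τ` in the Siegel space. -/
theorem isUnit_den (M : Sp g) {τ : Matrix (Fin g) (Fin g) ℂ} (hτ : IsSiegel τ) :
    IsUnit (den M τ).det := by
  rw [isUnit_iff_ne_zero]
  intro h0
  obtain ⟨v, hv, hQ⟩ := Matrix.exists_mulVec_eq_zero_iff.mpr h0
  have hpos := (isSiegel_iff.mp hτ).2 v hv
  have h := congrArg (fun A => star v ⬝ᵥ A *ᵥ v) (den_num_herm M τ)
  simp only [Matrix.add_mulVec, Matrix.sub_mulVec, dotProduct_sub,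
    ← Matrix.mulVec_mulVec, hQ, Matrix.mulVec_zero, zero_add] at h
  rw [im_quadratic, Matrix.dotProduct_mulVec, ← Matrix.star_mulVec, hQ, star_zero,
    zero_dotProduct] at h
  have := mul_ne_zero (mul_ne_zero two_ne_zero Complex.I_ne_zero)
    (Complex.ofReal_ne_zero.mpr hpos.ne')
  exact this h.symm

/-- The Siegel space is stable under `τ ↦ (a τ + b)(c τ + d)⁻¹`. -/
theorem isSiegel_smul (M : Sp g) {τ : Matrix (Fin g) (Fin g) ℂ} (hτ : IsSiegel τ) :
    IsSiegel (num M τ * (den M τ)⁻¹) := by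
  have hu := isUnit_den M hτ
  have hu' : IsUnit (den M τ)ᵀ.det := by rwa [Matrix.det_transpose]
  refine isSiegel_iff.mpr ⟨?_, fun w hw => ?_⟩
  · have h := den_num_symm M hτ.1
    unfold Matrix.IsSymm
    rw [Matrix.transpose_mul, Matrix.transpose_nonsing_inv]
    calc (den M τ)ᵀ⁻¹ * (num M τ)ᵀ
        = (den M τ)ᵀ⁻¹ * ((num M τ)ᵀ * den M τ) * (den M τ)⁻¹ := by
          rw [Matrix.mul_assoc, Matrix.mul_assoc, Matrix.mul_nonsing_inv _ hu, Matrix.mul_one]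
      _ = num M τ * (den M τ)⁻¹ := by
          rw [← h, ← Matrix.mul_assoc, Matrix.nonsing_inv_mul _ hu', Matrix.one_mul]
  · set v := (den M τ)⁻¹ *ᵥ w with hv
    have hw' : den M τ *ᵥ v = w := by
      rw [hv, Matrix.mulVec_mulVec, Matrix.mul_nonsing_inv _ hu, Matrix.one_mulVec]
    have hv0 : v ≠ 0 := fun h => hw (by rw [← hw', h, Matrix.mulVec_zero])
    have hpos := (isSiegel_iff.mp hτ).2 v hv0
    have e : star w ⬝ᵥ (num M τ * (den M τ)⁻¹) *ᵥ w =
        star v ⬝ᵥ ((den M τ)ᴴ * num M τ) *ᵥ v := by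
      rw [← Matrix.mulVec_mulVec, ← hv, ← Matrix.mulVec_mulVec, Matrix.dotProduct_mulVec (star v),
        ← Matrix.star_mulVec, hw']
    have h1 := im_quadratic ((den M τ)ᴴ * num M τ) v
    have h2 := im_quadratic τ v
    have h3 : (den M τ)ᴴ * num M τ - ((den M τ)ᴴ * num M τ)ᴴ = τ - τᴴ := by
      rw [Matrix.conjTranspose_mul, Matrix.conjTranspose_conjTranspose, den_num_herm]
      abel
    rw [← dotProduct_sub, ← Matrix.sub_mulVec] at h1 h2
    rw [h3, h2] at h1
    have h4 := mul_left_cancel₀ (mul_ne_zero two_ne_zero Complex.I_ne_zero) h1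
    rw [e, ← Complex.ofReal_inj.mp h4]
    exact hpos

theorem num_mul (M N : Sp g) (τ : Matrix (Fin g) (Fin g) ℂ) :
    num (M * N) τ = M.val.toBlocks₁₁.map (Int.cast : ℤ → ℂ) * num N τ +
      M.val.toBlocks₁₂.map (Int.cast : ℤ → ℂ) * den N τ := by
  obtain ⟨M, hM⟩ := M
  obtain ⟨N, hN⟩ := N
  have h := Matrix.fromBlocks_multiply M.toBlocks₁₁ M.toBlocks₁₂ M.toBlocks₂₁ M.toBlocks₂₂
    N.toBlocks₁₁ N.toBlocks₁₂ N.toBlocks₂₁ N.toBlocks₂₂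
  rw [Matrix.fromBlocks_toBlocks, Matrix.fromBlocks_toBlocks] at h
  have hm : ∀ A B : Matrix (Fin g) (Fin g) ℤ, (A * B).map (Int.cast : ℤ → ℂ) =
      A.map (Int.cast : ℤ → ℂ) * B.map (Int.cast : ℤ → ℂ) := fun A B =>
    Matrix.map_mul (f := Int.castRingHom ℂ)
  simp only [num, den, MulMemClass.mk_mul_mk, h, Matrix.toBlocks_fromBlocks₁₁,
    Matrix.toBlocks_fromBlocks₁₂, Matrix.map_add _ Int.cast_add, hm]
  noncomm_ring

theorem den_mul (M N : Sp g) (τ : Matrix (Fin g) (Fin g) ℂ) :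
    den (M * N) τ = M.val.toBlocks₂₁.map (Int.cast : ℤ → ℂ) * num N τ +
      M.val.toBlocks₂₂.map (Int.cast : ℤ → ℂ) * den N τ := by
  obtain ⟨M, hM⟩ := M
  obtain ⟨N, hN⟩ := N
  have h := Matrix.fromBlocks_multiply M.toBlocks₁₁ M.toBlocks₁₂ M.toBlocks₂₁ M.toBlocks₂₂
    N.toBlocks₁₁ N.toBlocks₁₂ N.toBlocks₂₁ N.toBlocks₂₂
  rw [Matrix.fromBlocks_toBlocks, Matrix.fromBlocks_toBlocks] at h
  have hm : ∀ A B : Matrix (Fin g) (Fin g) ℤ, (A * B).map (Int.cast : ℤ → ℂ) =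
      A.map (Int.cast : ℤ → ℂ) * B.map (Int.cast : ℤ → ℂ) := fun A B =>
    Matrix.map_mul (f := Int.castRingHom ℂ)
  simp only [num, den, MulMemClass.mk_mul_mk, h, Matrix.toBlocks_fromBlocks₂₁,
    Matrix.toBlocks_fromBlocks₂₂, Matrix.map_add _ Int.cast_add, hm]
  noncomm_ring

/-- The action `M • τ = (a τ + b)(c τ + d)⁻¹` of `Sp(2g, ℤ)` on the Siegel space. -/
instance : MulAction (Sp g) (SiegelSpace g) where
  smul M τ := ⟨⟨num M τ.1.toMatrix * (den M τ.1.toMatrix)⁻¹, (isSiegel_smul M τ.2).1⟩,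
    isSiegel_smul M τ.2⟩
  one_smul τ := by
    refine Subtype.ext (Subtype.ext ?_)
    change num 1 τ.1.toMatrix * (den 1 τ.1.toMatrix)⁻¹ = τ.1.toMatrix
    have hn : num (1 : Sp g) τ.1.toMatrix = τ.1.toMatrix := by
      rw [num, OneMemClass.coe_one, ← Matrix.fromBlocks_one, Matrix.toBlocks_fromBlocks₁₁,
        Matrix.toBlocks_fromBlocks₁₂]
      simp
    have hd : den (1 : Sp g) τ.1.toMatrix = 1 := by
      rw [den, OneMemClass.coe_one, ← Matrix.fromBlocks_one, Matrix.toBlocks_fromBlocks₂₁,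
        Matrix.toBlocks_fromBlocks₂₂]
      simp
    rw [hn, hd]; simp
  mul_smul M N τ := by
    refine Subtype.ext (Subtype.ext ?_)
    change num (M * N) τ.1.toMatrix * (den (M * N) τ.1.toMatrix)⁻¹ =
      num M (num N τ.1.toMatrix * (den N τ.1.toMatrix)⁻¹) *
        (den M (num N τ.1.toMatrix * (den N τ.1.toMatrix)⁻¹))⁻¹
    have hu := isUnit_den N τ.2
    have h1 : num M (num N τ.1.toMatrix * (den N τ.1.toMatrix)⁻¹) =
        num (M * N) τ.1.toMatrix * (den N τ.1.toMatrix)⁻¹ := by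
      rw [num_mul, Matrix.add_mul, Matrix.mul_assoc, Matrix.mul_assoc,
        Matrix.mul_nonsing_inv _ hu, Matrix.mul_one, num]
    have h2 : den M (num N τ.1.toMatrix * (den N τ.1.toMatrix)⁻¹) =
        den (M * N) τ.1.toMatrix * (den N τ.1.toMatrix)⁻¹ := by
      rw [den_mul, Matrix.add_mul, Matrix.mul_assoc, Matrix.mul_assoc,
        Matrix.mul_nonsing_inv _ hu, Matrix.mul_one, den]
    rw [h1, h2, Matrix.mul_inv_rev, Matrix.nonsing_inv_nonsing_inv _ hu, Matrix.mul_assoc,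
      ← Matrix.mul_assoc (den N τ.1.toMatrix)⁻¹, Matrix.nonsing_inv_mul _ hu, Matrix.one_mul]

theorem coe_smul (M : Sp g) (τ : SiegelSpace g) :
    (M • τ).1.toMatrix = num M τ.1.toMatrix * (den M τ.1.toMatrix)⁻¹ := rfl

end Action

/-! ## Forms on the Siegel space and on `A_g` -/

section Descent

variable {g : ℕ}

open Classical in
/-- The map `τ ↦ M • τ`, extended by the identity outside the (open) Siegel space. -/
def actMap (M : Sp g) (τ : SymMat g) : SymMat g :=
  if h : τ ∈ siegelSet g then (M • (⟨τ, h⟩ : SiegelSpace g)).1 else τ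

/-- The differential at `τ` of the biholomorphism `τ ↦ M • τ` of the Siegel space. -/
def actDeriv (M : Sp g) (τ : SiegelSpace g) : SymMat g →L[ℝ] SymMat g :=
  (fderiv ℂ (actMap M) τ.1).restrictScalars ℝ

/-- The pullback `M^* Ω` of a 2-form on the Siegel space by `τ ↦ M • τ`. -/
def actPullback (M : Sp g) (Ω : SiegelSpace g → TwoForm (SymMat g)) (τ : SiegelSpace g) :
    TwoForm (SymMat g) :=
  (Ω (M • τ)).compContinuousLinearMap (actDeriv M τ)

open Classical in
/-- Smoothness of a 2-form on the Siegel space, an open set of the space of symmetric matrices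
(the value chosen outside is irrelevant). -/
def IsSmoothForm (Ω : SiegelSpace g → TwoForm (SymMat g)) : Prop :=
  ContDiffOn ℝ ∞ (fun τ : SymMat g => if h : τ ∈ siegelSet g then Ω ⟨τ, h⟩ else 0) (siegelSet g)

/-- `Ω` is of type `(1, 1)`, that is `Ω(i v, i w) = Ω(v, w)`. -/
def IsOneOne (Ω : SiegelSpace g → TwoForm (SymMat g)) : Prop :=
  ∀ (τ : SiegelSpace g) (v w : SymMat g),
    Ω τ ![Complex.I • v, Complex.I • w] = Ω τ ![v, w]

/-- The quotient `A_g = Sp(2g, ℤ) \ ℍ_g`. -/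
abbrev Ag (g : ℕ) : Type := MulAction.orbitRel.Quotient (Sp g) (SiegelSpace g)

/-- The projection `π : ℍ_g → A_g`. -/
def Ag.mk (τ : SiegelSpace g) : Ag g := Quotient.mk'' τ

theorem Ag.mk_smul (M : Sp g) (τ : SiegelSpace g) : Ag.mk (M • τ) = Ag.mk τ :=
  Quotient.sound' (MulAction.mem_orbit τ M)

/-- A smooth `(1, 1)`-form on `A_g`, in the orbifold sense. Its value at a point `x` of `A_g` is
a family of 2-forms on the tangent spaces of `ℍ_g` at the points `τ` above `x`, which correspond to
each other under the differentials of the elements of `Sp(2g, ℤ)` (in particular each of them is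
invariant under the stabilizer of `τ`). Smoothness and type are those in the orbifold chart
`ℍ_g → A_g`. -/
structure AgForm (g : ℕ) where
  toFun : ∀ (x : Ag g) (τ : SiegelSpace g), Ag.mk τ = x → TwoForm (SymMat g)
  compatible : ∀ (x : Ag g) (τ : SiegelSpace g) (hτ : Ag.mk τ = x) (M : Sp g),
    (toFun x (M • τ) ((Ag.mk_smul M τ).trans hτ)).compContinuousLinearMap (actDeriv M τ) =
      toFun x τ hτ
  smooth : IsSmoothForm fun τ => toFun (Ag.mk τ) τ rfl
  oneOne : IsOneOne fun τ => toFun (Ag.mk τ) τ rfl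

/-- The pullback `π^* η` to the Siegel space of a form `η` on `A_g`. -/
def AgForm.pullback (η : AgForm g) (τ : SiegelSpace g) : TwoForm (SymMat g) :=
  η.toFun (Ag.mk τ) τ rfl

end Descent

/-! ## Second order theta functions -/

section Theta

variable {g : ℕ}

/-- The second order theta function
`θ_u(z; τ) = ∑_{m ∈ ℤ^g} exp(2πi (m+u)ᵗ τ (m+u) + 4πi (m+u)ᵗ z)`, for a vector `u`. -/
def secondOrderTheta (u : Fin g → ℝ) (z : Fin g → ℂ) (τ : Matrix (Fin g) (Fin g) ℂ) : ℂ :=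
  ∑' m : Fin g → ℤ,
    Complex.exp
      (2 * Real.pi * Complex.I *
          ((fun i => (m i : ℂ) + (u i : ℂ)) ⬝ᵥ τ *ᵥ (fun i => (m i : ℂ) + (u i : ℂ))) +
        4 * Real.pi * Complex.I * ((fun i => (m i : ℂ) + (u i : ℂ)) ⬝ᵥ z))

/-- `θ_u` depends only on `u` modulo `ℤ^g`. -/
theorem secondOrderTheta_add_int (u : Fin g → ℝ) (n : Fin g → ℤ) (z : Fin g → ℂ)
    (τ : Matrix (Fin g) (Fin g) ℂ) :
    secondOrderTheta (fun i => u i + n i) z τ = secondOrderTheta u z τ := by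
  unfold secondOrderTheta
  conv_rhs => rw [← (Equiv.addRight n).tsum_eq]
  refine tsum_congr fun m => ?_
  have : (fun i => ((Equiv.addRight n m i : ℤ) : ℂ) + (u i : ℂ)) =
      fun i => (m i : ℂ) + ((u i + n i : ℝ) : ℂ) := by
    funext i; simp; ring
  rw [this]

/-- The representative in `{0, 1/2}^g` of the element `α / 2` of `U = (½ ℤ^g) / ℤ^g`, for
`α ∈ (ℤ/2)^g`. -/
def halfRep (α : Fin g → ZMod 2) (i : Fin g) : ℝ := ((α i).val : ℝ) / 2

/-- The vector `(θ_u(0; τ))_{u ∈ U}` of second order theta constants. Here `U = (½ ℤ^g) / ℤ^g` is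
identified with `(ℤ/2)^g` by `u = α / 2`. -/
def thetaNull (τ : SymMat g) : EuclideanSpace ℂ (Fin g → ZMod 2) :=
  WithLp.toLp 2 fun α => secondOrderTheta (halfRep α) 0 τ.toMatrix

/-- The second order theta nullwert map `Θ : ℍ_g → ℙ^{2^g-1}`, `τ ↦ [θ_u(0; τ)]_{u ∈ U}`, once it is
known that the second order theta constants have no common zero. -/
def thetaMap (h : ∀ τ : SiegelSpace g, thetaNull τ.1 ≠ 0) (τ : SiegelSpace g) :
    Projectivization ℂ (EuclideanSpace ℂ (Fin g → ZMod 2)) :=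
  Projectivization.mk ℂ (thetaNull τ.1) (h τ)

end Theta

end ThetaFS

end

open ThetaFS

open scoped ContDiff Matrix

noncomputable section

namespace ThetaFS

/-! ### The form `∂∂̄ log |F|²`: explicit value, effect of holomorphic factors. -/

section Forms

variable {E V : Type*} [NormedAddCommGroup E] [NormedSpace ℂ E]
  [NormedAddCommGroup V] [InnerProductSpace ℂ V]

/-! The heart of the matter is the identity `|Θ(Mτ)|² = |det(cτ+d)| |Θ(τ)|²`
(`normSq_thetaNull_smul`). The function `det(cτ+d)` is holomorphic without zeros, so `∂∂̄` kills the
logarithm of its absolute value, and `(i/2) ∂∂̄ log |Θ|²` is invariant (`fsValue_eq_of_normSq_eq`,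
`actPullback_thetaForm`). Only the sum of squares enters: neither the transformation law of the
individual theta constants nor generators of the symplectic group are needed.

For the identity, write `τ = x + iy` and expand `∑ |θ_α|²` as a sum over `(α, m, n)`. With `p = m +
n + α` and `q = m - n`, the pair `(p, q)` runs exactly once through `ℤ^g × ℤ^g` (`sumDiffEquiv`),
and the summand becomes `exp(-π(pᵗyp + qᵗyq) + 2πi pᵗxq)` (`thetaTerm_mul_conj`). Poisson summation
in `p` (`tsum_exp_neg_pi_quadratic`) turns the sum into `(det y)^(-1/2) ∑ exp(-π Q_τ(k, q))`, where
`Q_τ(k, q) = (k - τq)^* y⁻¹ (k - τq)` is `majorant`. The symplectic group permutes the lattice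
vectors `(k, q)` and carries `Q_τ` to `Q_{Mτ}` (`majorant_smul`), so only `det y` changes, by the
factor `|det(cτ+d)|^(-2)` (`det_im_smul`). All terms being positive, the same formula shows that the
theta constants have no common zero.

Locally uniform Gaussian bounds make the theta constants holomorphic. Two holomorphic lifts of `Θ`
differ by a holomorphic factor without zeros, which does not affect the pulled back form. A form on
the orbifold is by definition an invariant family on `ℍ_g`, so invariance gives existence, and
uniqueness is immediate. -/

/-- The value at `(v, w)` of the form `∂∂̄ log |Z|²` at `Z`. -/
def fsValue (Z v w : V) : ℂ :=
  (inner ℂ w v - inner ℂ v w) / inner ℂ Z Z -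
    (inner ℂ w Z * inner ℂ Z v - inner ℂ v Z * inner ℂ Z w) / inner ℂ Z Z ^ 2

/-- This is descent to projective space: by the Leibniz rule, `c • v + a • Z` is the shape of the
derivative of a rescaled lift `c F`. -/
theorem fsValue_smul_add (Z v w : V) {c : ℂ} (hc : c ≠ 0) (a b : ℂ) (hZ : Z ≠ 0) :
    fsValue (c • Z) (c • v + a • Z) (c • w + b • Z) = fsValue Z v w := by
  have h : inner ℂ Z Z ≠ 0 := inner_self_ne_zero.mpr hZ
  have hc' : (starRingEnd ℂ) c ≠ 0 := (map_ne_zero _).mpr hc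
  simp only [fsValue, inner_add_left, inner_add_right, inner_smul_left, inner_smul_right]
  field_simp
  ring

/-- `ℙ⁰` is a point. Together with `deldelbar_log_normSq` this says that `log |j|²` is pluriharmonic
where `j` is holomorphic and nonzero. -/
theorem fsValue_complex (Z v w : ℂ) : fsValue Z v w = 0 := by
  by_cases hZ : Z = 0
  · simp [fsValue, hZ]
  have hc' : (starRingEnd ℂ) Z ≠ 0 := (map_ne_zero _).mpr hZ
  simp only [fsValue, RCLike.inner_apply]
  field_simp
  ring

theorem fsValue_I_smul (Z v w : V) :
    fsValue Z (Complex.I • v) (Complex.I • w) = fsValue Z v w := by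
  simp only [fsValue, inner_smul_left, inner_smul_right, Complex.conj_I]
  congr 2 <;> ring_nf <;> simp <;> ring

theorem delbar_apply (f : E → ℂ) (x : E) (v : Fin 1 → E) :
    delbar f x v =
      (fderiv ℝ f x (v 0) + Complex.I * fderiv ℝ f x (Complex.I • v 0)) / 2 := by
  simp [delbar]
  ring

theorem contDiffAt_delbar {f : E → ℂ} {x : E} {n : ℕ∞ω} (h : ContDiffAt ℝ (n + 1) f x) :
    ContDiffAt ℝ n (delbar f) x := by
  have h1 : ContDiffAt ℝ n (fderiv ℝ f) x := h.fderiv_right le_rfl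
  have h2 := (h1.add ((h1.clm_comp (contDiffAt_const (c :=
      (Complex.I • ContinuousLinearMap.id ℂ E).restrictScalars ℝ))).const_smul
        Complex.I)).const_smul (1 / 2 : ℂ)
  exact (ContinuousAlternatingMap.ofSubsingletonLIE (𝕜 := ℝ) (E := E) (F := ℂ) (0 : Fin 1)).contDiff.contDiffAt.comp x h2

theorem contDiffAt_deldelbar {f : E → ℂ} {x : E} (h : ContDiffAt ℝ ∞ f x) :
    ContDiffAt ℝ ∞ (deldelbar f) x := by
  have h1 : ContDiffAt ℝ ∞ (delbar f) x := contDiffAt_delbar h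
  have h2 : ContDiffAt ℝ ∞ (fderiv ℝ (delbar f)) x := h1.fderiv_right le_rfl
  exact (ContinuousAlternatingMap.alternatizeUncurryFinCLM ℝ E ℂ).contDiff.contDiffAt.comp x h2

theorem contDiffAt_log_normSq {F : E → V} {x : E} {n : ℕ∞ω} (hF : ContDiffAt ℂ n F x)
    (hx : F x ≠ 0) :
    ContDiffAt ℝ n (fun y => ((Real.log (‖F y‖ ^ 2) : ℝ) : ℂ)) x := by
  let _ : InnerProductSpace ℝ V := InnerProductSpace.rclikeToReal ℂ V
  have h := ((hF.restrict_scalars ℝ).norm_sq ℝ).log (by simpa using hx)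
  exact Complex.ofRealCLM.contDiff.contDiffAt.comp x h

theorem ofReal_normSq (z : V) : ((‖z‖ ^ 2 : ℝ) : ℂ) = inner ℂ z z := by
  rw [inner_self_eq_norm_sq_to_K]; push_cast; rfl

theorem fderiv_log_normSq {F : E → V} {x : E} (hF : DifferentiableAt ℂ F x) (hx : F x ≠ 0) (v : E) :
    fderiv ℝ (fun y => ((Real.log (‖F y‖ ^ 2) : ℝ) : ℂ)) x v =
      (inner ℂ (fderiv ℂ F x v) (F x) + inner ℂ (F x) (fderiv ℂ F x v)) / inner ℂ (F x) (F x) := by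
  let _ : InnerProductSpace ℝ V := InnerProductSpace.rclikeToReal ℂ V
  have hR : DifferentiableAt ℝ F x := hF.restrictScalars ℝ
  have hN : DifferentiableAt ℝ (fun y => ‖F y‖ ^ 2) x := hR.norm_sq ℝ
  have h0 : ‖F x‖ ^ 2 ≠ 0 := by simpa using hx
  have h1 := (Complex.ofRealCLM.hasFDerivAt.comp x hN.hasFDerivAt)
  have h2 := (Complex.ofRealCLM.hasFDerivAt.comp x (hN.hasFDerivAt.log h0)).fderiv
  have h3 : (Complex.ofRealCLM ∘ fun y => ‖F y‖ ^ 2) = fun y => inner ℂ (F y) (F y) :=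
    funext fun y => ofReal_normSq (F y)
  have h4 := fderiv_inner_apply ℂ hR hR v
  rw [← h3, h1.fderiv, hF.fderiv_restrictScalars ℝ] at h4
  change fderiv ℝ (Complex.ofRealCLM ∘ fun y => Real.log (‖F y‖ ^ 2)) x v = _
  rw [h2, ← ofReal_normSq]
  simp only [ContinuousLinearMap.comp_apply, _root_.smul_apply, smul_eq_mul,
    Complex.ofRealCLM_apply, Complex.ofReal_mul, Complex.ofReal_inv] at h4 ⊢
  rw [h4, div_eq_inv_mul]
  simp [add_comm]

/-- Of the two summands in the derivative of `|F|²`, one is antilinear and the other linear in the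
tangent vector; `∂̄` keeps the antilinear one. -/
theorem delbar_log_normSq {F : E → V} {x : E} (hF : DifferentiableAt ℂ F x) (hx : F x ≠ 0)
    (v : Fin 1 → E) :
    delbar (fun y => ((Real.log (‖F y‖ ^ 2) : ℝ) : ℂ)) x v =
      inner ℂ (fderiv ℂ F x (v 0)) (F x) / inner ℂ (F x) (F x) := by
  rw [delbar_apply, fderiv_log_normSq hF hx, fderiv_log_normSq hF hx, map_smul, inner_smul_left,
    inner_smul_right, Complex.conj_I]
  linear_combination (norm := ring_nf)
    (inner ℂ (F x) (fderiv ℂ F x (v 0)) - inner ℂ (fderiv ℂ F x (v 0)) (F x)) /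
      inner ℂ (F x) (F x) / 2 * Complex.I_sq

theorem fderiv_delbar_log_normSq {F : E → V} {x : E} (hF : ContDiffAt ℂ 2 F x)
    (hx : F x ≠ 0) (v : E) (w : Fin 1 → E) :
    fderiv ℝ (fun y => delbar (fun y => ((Real.log (‖F y‖ ^ 2) : ℝ) : ℂ)) y w) x v =
      (inner ℂ (fderiv ℂ (fderiv ℂ F) x v (w 0)) (F x) +
        inner ℂ (fderiv ℂ F x (w 0)) (fderiv ℂ F x v)) / inner ℂ (F x) (F x) -
      inner ℂ (fderiv ℂ F x (w 0)) (F x) * (inner ℂ (fderiv ℂ F x v) (F x) +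
        inner ℂ (F x) (fderiv ℂ F x v)) / inner ℂ (F x) (F x) ^ 2 := by
  have hd : DifferentiableAt ℂ F x := hF.differentiableAt (by norm_num)
  have hR : DifferentiableAt ℝ F x := hd.restrictScalars ℝ
  have hd2 : DifferentiableAt ℂ (fderiv ℂ F) x :=
    (hF.fderiv_right (m := 1) (by norm_num)).differentiableAt (by norm_num)
  have hd3 : DifferentiableAt ℂ (fun y => fderiv ℂ F y (w 0)) x :=
    hd2.clm_apply (differentiableAt_const _)
  have hR3 := hd3.restrictScalars ℝ
  have hD : fderiv ℝ (fun y => fderiv ℂ F y (w 0)) x v = fderiv ℂ (fderiv ℂ F) x v (w 0) := by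
    rw [hd3.fderiv_restrictScalars ℝ]
    simp [fderiv_clm_apply hd2 (differentiableAt_const (w 0))]
  have h0 : inner ℂ (F x) (F x) ≠ 0 := inner_self_ne_zero.mpr hx
  -- The formula for `∂̄` is needed on a neighbourhood of `x`, since it is about to be
  -- differentiated.
  have hev : (fun y => delbar (fun y => ((Real.log (‖F y‖ ^ 2) : ℝ) : ℂ)) y w) =ᶠ[nhds x]
      fun y => inner ℂ (fderiv ℂ F y (w 0)) (F y) * (inner ℂ (F y) (F y))⁻¹ := by
    have e1 : ∀ᶠ y in nhds x, DifferentiableAt ℂ F y :=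
      (hF.eventually (by norm_num)).mono fun y hy => hy.differentiableAt (by norm_num)
    filter_upwards [e1, hd.continuousAt.eventually_ne hx] with y h1 h2
    rw [delbar_log_normSq h1 h2, div_eq_mul_inv]
  rw [hev.fderiv_eq]
  have hA := (hR3.inner ℂ hR).hasFDerivAt
  have hB := (hR.inner ℂ hR).hasFDerivAt
  have hC := (hasFDerivAt_inv h0).restrictScalars ℝ |>.comp x hB
  have := (hA.fun_mul hC).fderiv
  simp only [Function.comp_def] at this
  rw [this]
  simp only [_root_.add_apply, _root_.smul_apply, ContinuousLinearMap.comp_apply,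
    ContinuousLinearMap.coe_restrictScalars', ContinuousLinearMap.toSpanSingleton_apply,
    smul_eq_mul, fderiv_inner_apply ℂ hR3 hR, fderiv_inner_apply ℂ hR hR, hD,
    hd.fderiv_restrictScalars ℝ]
  field_simp
  ring

theorem differentiableAt_delbar_log_normSq {F : E → V} {x : E} (hF : ContDiffAt ℂ 2 F x)
    (hx : F x ≠ 0) :
    DifferentiableAt ℝ (delbar fun y => ((Real.log (‖F y‖ ^ 2) : ℝ) : ℂ)) x := by
  have h : ContDiffAt ℝ (1 + 1) (fun y => ((Real.log (‖F y‖ ^ 2) : ℝ) : ℂ)) x := by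
    rw [one_add_one_eq_two]; exact contDiffAt_log_normSq hF hx
  exact (contDiffAt_delbar h).differentiableAt (by norm_num)

/-- Antisymmetrising in `v` and `w` cancels the second derivatives of `F`, which are symmetric. Only
`F x` and its first derivative remain, so the form is the pullback by `F` of the one obtained for
the identity map. -/
theorem deldelbar_log_normSq {F : E → V} {x : E} (hF : ContDiffAt ℂ 2 F x) (hx : F x ≠ 0)
    (v w : E) :
    deldelbar (fun y => ((Real.log (‖F y‖ ^ 2) : ℝ) : ℂ)) x ![v, w] =
      fsValue (F x) (fderiv ℂ F x v) (fderiv ℂ F x w) := by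
  have hd := differentiableAt_delbar_log_normSq hF hx
  have hsymm : fderiv ℂ (fderiv ℂ F) x v w = fderiv ℂ (fderiv ℂ F) x w v :=
    (hF.isSymmSndFDerivAt (by simp)).eq v w
  rw [deldelbar, extDeriv_apply hd, Fin.sum_univ_two,
    fderiv_delbar_log_normSq hF hx, fderiv_delbar_log_normSq hF hx]
  simp [Fin.removeNth, hsymm, fsValue]
  ring

theorem fubiniStudy_apply {ι : Type*} [Fintype ι] {Z : EuclideanSpace ℂ ι} (hZ : Z ≠ 0)
    (v w : EuclideanSpace ℂ ι) :
    fubiniStudy ι Z ![v, w] = Complex.I / 2 * fsValue Z v w := by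
  have := deldelbar_log_normSq (F := fun Y : EuclideanSpace ℂ ι => Y) contDiffAt_id hZ v w
  simp only [fderiv_fun_id, ContinuousLinearMap.id_apply] at this
  rw [fubiniStudy, ContinuousAlternatingMap.smul_apply, this, smul_eq_mul]

theorem pullback_fubiniStudy_apply {ι : Type*} [Fintype ι] {F : E → EuclideanSpace ℂ ι} {x : E}
    (hx : F x ≠ 0) (v w : E) :
    pullback F (fubiniStudy ι) x ![v, w] =
      Complex.I / 2 * fsValue (F x) (fderiv ℂ F x v) (fderiv ℂ F x w) := by
  rw [← fubiniStudy_apply hx, pullback, ContinuousAlternatingMap.compContinuousLinearMap_apply]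
  congr 1
  ext i
  fin_cases i <;> rfl

theorem twoForm_ext {α β : TwoForm E} (h : ∀ v w, α ![v, w] = β ![v, w]) : α = β := by
  ext m
  have : m = ![m 0, m 1] := by ext i; fin_cases i <;> rfl
  rw [this, h]

/-- The right hand side is visibly smooth in `x`; this is how smoothness of the pulled back form is
obtained. -/
theorem pullback_fubiniStudy_eq_deldelbar {ι : Type*} [Fintype ι] {F : E → EuclideanSpace ℂ ι}
    {x : E} (hF : ContDiffAt ℂ 2 F x) (hx : F x ≠ 0) :
    pullback F (fubiniStudy ι) x =
      (Complex.I / 2) • deldelbar (fun y => ((Real.log (‖F y‖ ^ 2) : ℝ) : ℂ)) x :=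
  twoForm_ext fun v w => by
    rw [pullback_fubiniStudy_apply hx, ContinuousAlternatingMap.smul_apply,
      deldelbar_log_normSq hF hx, smul_eq_mul]

/-- Proportional holomorphic homogeneous coordinates pull back the Fubini–Study form to the
same form. -/
theorem pullback_fubiniStudy_congr_smul {ι : Type*} [Fintype ι] {F G : E → EuclideanSpace ℂ ι}
    {c : E → ℂ} {x : E} (hF : DifferentiableAt ℂ F x) (hG : DifferentiableAt ℂ G x)
    (hx : F x ≠ 0) (hc : c x ≠ 0) (h : ∀ᶠ y in nhds x, G y = c y • F y) :
    pullback G (fubiniStudy ι) x = pullback F (fubiniStudy ι) x := by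
  have hGx : G x = c x • F x := h.self_of_nhds
  -- No regularity of `c` is assumed. A linear form `φ` that does not vanish at `F x` recovers it
  -- near `x` as the holomorphic quotient `φ(G) / φ(F)`.
  obtain ⟨φ, hφ⟩ : ∃ φ : EuclideanSpace ℂ ι →L[ℂ] ℂ, φ (F x) ≠ 0 :=
    ⟨innerSL ℂ (F x), inner_self_ne_zero.mpr hx⟩
  have hcd : DifferentiableAt ℂ c x := by
    have hev : c =ᶠ[nhds x] fun y => φ (G y) * (φ (F y))⁻¹ := by
      have h1 : ∀ᶠ y in nhds x, φ (F y) ≠ 0 :=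
        (φ.continuous.continuousAt.comp hF.continuousAt).eventually_ne hφ
      filter_upwards [h, h1] with y h2 h3
      rw [h2, map_smul, smul_eq_mul, mul_inv_cancel_right₀ h3]
    have h1 : DifferentiableAt ℂ (fun y => φ (G y)) x := φ.differentiableAt.comp x hG
    have h2 : DifferentiableAt ℂ (fun y => φ (F y)) x := φ.differentiableAt.comp x hF
    have h3 : DifferentiableAt ℂ (fun y => φ (G y) * (φ (F y))⁻¹) x :=
      h1.mul (h2.inv hφ)
    exact h3.congr_of_eventuallyEq hev
  have hD : fderiv ℂ G x = c x • fderiv ℂ F x + (fderiv ℂ c x).smulRight (F x) := by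
    rw [Filter.EventuallyEq.fderiv_eq h]
    exact fderiv_fun_smul hcd hF
  refine twoForm_ext fun v w => ?_
  rw [pullback_fubiniStudy_apply hx, pullback_fubiniStudy_apply (by simp [hGx, hc, hx]), hD, hGx]
  simp only [_root_.add_apply, _root_.smul_apply,
    ContinuousLinearMap.smulRight_apply]
  rw [fsValue_smul_add _ _ _ hc _ _ hx]

/-- `∂∂̄ log |F|²` does not change when `|F|²` is multiplied by the absolute value of a
holomorphic function without zeros. -/
theorem fsValue_eq_of_normSq_eq {ι κ : Type*} [Fintype ι] [Fintype κ] {F : E → EuclideanSpace ℂ ι}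
    {G : E → EuclideanSpace ℂ κ} {j : E → ℂ} {x : E} (hF : ContDiffAt ℂ 2 F x)
    (hG : ContDiffAt ℂ 2 G x) (hj : ContDiffAt ℂ 2 j x) (hFx : F x ≠ 0) (hGx : G x ≠ 0)
    (hjx : j x ≠ 0) (h : ∀ᶠ y in nhds x, ‖G y‖ ^ 2 = ‖j y‖ * ‖F y‖ ^ 2) (v w : E) :
    fsValue (G x) (fderiv ℂ G x v) (fderiv ℂ G x w) =
      fsValue (F x) (fderiv ℂ F x v) (fderiv ℂ F x w) := by
  have e1 : ∀ᶠ y in nhds x, DifferentiableAt ℂ F y :=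
    (hF.eventually (by norm_num)).mono fun y hy => hy.differentiableAt (by norm_num)
  have e2 : ∀ᶠ y in nhds x, DifferentiableAt ℂ j y :=
    (hj.eventually (by norm_num)).mono fun y hy => hy.differentiableAt (by norm_num)
  have n1 : ∀ᶠ y in nhds x, F y ≠ 0 := hF.continuousAt.eventually_ne hFx
  have n2 : ∀ᶠ y in nhds x, j y ≠ 0 := hj.continuousAt.eventually_ne hjx
  -- Writing `log |j|` as half of `log |j|²` lets `deldelbar_log_normSq` apply to `j` as a map to
  -- `ℂ`, where `fsValue` vanishes.
  have hev : (fun y => ((Real.log (‖G y‖ ^ 2) : ℝ) : ℂ)) =ᶠ[nhds x] fun y =>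
      ((Real.log (‖F y‖ ^ 2) : ℝ) : ℂ) +
        (1 / 2 : ℝ) • ((Real.log (‖j y‖ ^ 2) : ℝ) : ℂ) := by
    filter_upwards [h, n1, n2] with y hy h1 h2
    rw [hy, Real.log_mul (by simpa using h2) (by simpa using h1), Real.log_pow ‖j y‖,
      Complex.real_smul]
    push_cast
    ring
  have hdelbar : delbar (fun y => ((Real.log (‖G y‖ ^ 2) : ℝ) : ℂ)) =ᶠ[nhds x]
      delbar (fun y => ((Real.log (‖F y‖ ^ 2) : ℝ) : ℂ)) +
        (1 / 2 : ℝ) • delbar (fun y => ((Real.log (‖j y‖ ^ 2) : ℝ) : ℂ)) := by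
    filter_upwards [hev.eventually_nhds, e1, e2, n1, n2] with y hy d1 d2 h1 h2
    have D1 : DifferentiableAt ℝ (fun y => ((Real.log (‖F y‖ ^ 2) : ℝ) : ℂ)) y :=
      Complex.ofRealCLM.differentiableAt.comp y
        (((d1.restrictScalars ℝ).norm_sq ℂ).log (by simpa using h1))
    have D2 : DifferentiableAt ℝ (fun y => ((Real.log (‖j y‖ ^ 2) : ℝ) : ℂ)) y :=
      Complex.ofRealCLM.differentiableAt.comp y
        (((d2.restrictScalars ℝ).norm_sq ℂ).log (by simpa using h2))
    ext m
    simp only [Pi.add_apply, Pi.smul_apply, ContinuousAlternatingMap.add_apply,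
      ContinuousAlternatingMap.smul_apply, delbar_apply]
    rw [Filter.EventuallyEq.fderiv_eq hy, fderiv_fun_add D1 (D2.fun_const_smul _),
      fderiv_fun_const_smul D2]
    simp only [_root_.add_apply, _root_.smul_apply, Complex.real_smul]
    ring
  have hF2 := deldelbar_log_normSq hF hFx v w
  have hj2 := deldelbar_log_normSq hj hjx v w
  rw [fsValue_complex, deldelbar] at hj2
  rw [deldelbar] at hF2
  rw [← deldelbar_log_normSq hG hGx, deldelbar, hdelbar.extDeriv_eq,
    extDeriv_add (differentiableAt_delbar_log_normSq hF hFx)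
      ((differentiableAt_delbar_log_normSq hj hjx).const_smul _), extDeriv_smul,
    ContinuousAlternatingMap.add_apply, ContinuousAlternatingMap.smul_apply, hF2, hj2, smul_zero,
    add_zero]

end Forms

/-! ## Positive definite quadratic forms -/

section QuadraticForms

variable {n : ℕ}

theorem dotProduct_mulVec_smul (y : Matrix (Fin n) (Fin n) ℝ) (c : ℝ) (x : Fin n → ℝ) :
    (c • x) ⬝ᵥ y *ᵥ (c • x) = c ^ 2 * (x ⬝ᵥ y *ᵥ x) := by
  rw [Matrix.mulVec_smul, smul_dotProduct, dotProduct_smul, smul_eq_mul, smul_eq_mul]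
  ring

theorem posDef_iff_real {y : Matrix (Fin n) (Fin n) ℝ} :
    y.PosDef ↔ y.IsSymm ∧ ∀ x : Fin n → ℝ, x ≠ 0 → 0 < x ⬝ᵥ y *ᵥ x := by
  rw [Matrix.posDef_iff_dotProduct_mulVec]
  simp [Matrix.IsHermitian, Matrix.IsSymm, Matrix.conjTranspose_eq_transpose_of_trivial]

/-- A positive definite quadratic form is bounded below by a multiple of the sum of squares. -/
theorem exists_lower_bound {y : Matrix (Fin n) (Fin n) ℝ} (hy : y.PosDef) :
    ∃ c : ℝ, 0 < c ∧ ∀ x : Fin n → ℝ, c * ∑ i, x i ^ 2 ≤ x ⬝ᵥ y *ᵥ x := by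
  -- In dimension zero the unit sphere is empty and there is no minimum to take.
  rcases n with _ | n
  · exact ⟨1, one_pos, fun x => by simp⟩
  have hpos := (posDef_iff_real.mp hy).2
  have hcont : Continuous fun x : Fin (n + 1) → ℝ => x ⬝ᵥ y *ᵥ x := by
    simp only [dotProduct, Matrix.mulVec]; fun_prop
  obtain ⟨x₀, hx₀, hmin⟩ := (isCompact_sphere (0 : Fin (n + 1) → ℝ) 1).exists_isMinOn
    (NormedSpace.sphere_nonempty.mpr zero_le_one) hcont.continuousOn
  have hx₀' : x₀ ≠ 0 := by
    rintro rfl; simp at hx₀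
  set δ := x₀ ⬝ᵥ y *ᵥ x₀ with hδ
  have hδ0 : 0 < δ := hpos x₀ hx₀'
  -- The norm is the sup norm, so the sum of the `n + 1` squares is at most `(n + 1) ‖x‖²`.
  refine ⟨δ / (n + 1), by positivity, fun x => ?_⟩
  rcases eq_or_ne x 0 with rfl | hx
  · simp
  have hxn : 0 < ‖x‖ := norm_pos_iff.mpr hx
  have h1 : δ ≤ (‖x‖⁻¹ • x) ⬝ᵥ y *ᵥ (‖x‖⁻¹ • x) :=
    hmin (by simp [norm_smul, hxn.ne'])
  rw [dotProduct_mulVec_smul, inv_pow, ← div_eq_inv_mul, le_div_iff₀ (by positivity)] at h1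
  have h2 : ∑ i, x i ^ 2 ≤ (n + 1) * ‖x‖ ^ 2 := by
    calc ∑ i, x i ^ 2 ≤ ∑ _i : Fin (n + 1), ‖x‖ ^ 2 := Finset.sum_le_sum fun i _ => by
          rw [← sq_abs]
          exact pow_le_pow_left₀ (abs_nonneg _) (norm_le_pi_norm x i) 2
      _ = (n + 1) * ‖x‖ ^ 2 := by simp
  calc δ / (n + 1) * ∑ i, x i ^ 2 ≤ δ / (n + 1) * ((n + 1) * ‖x‖ ^ 2) := by gcongr
    _ = δ * ‖x‖ ^ 2 := by field_simp
    _ ≤ _ := h1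

end QuadraticForms

/-! ## Summability of Gaussian series -/

section Summability

theorem summable_exp_neg_sq {c : ℝ} (hc : 0 < c) :
    Summable fun m : ℤ => Real.exp (-c * (m : ℝ) ^ 2) := by
  -- The series is Jacobi's theta series at `z = 0` and `τ = i c / π`.
  have h := ((summable_jacobiTheta₂_term_iff 0 (Complex.I * (c / Real.pi : ℝ))).mpr (by
    simp; positivity)).norm
  refine h.congr fun m => ?_
  rw [jacobiTheta₂_term, Complex.norm_exp]
  congr 1
  have : (Real.pi : ℂ) ≠ 0 := by simp [Real.pi_ne_zero]
  have e : 2 * (Real.pi : ℂ) * Complex.I * (m : ℂ) * 0 +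
      (Real.pi : ℂ) * Complex.I * (m : ℂ) ^ 2 * (Complex.I * (c / Real.pi : ℝ)) =
      ((-c * (m : ℝ) ^ 2 : ℝ) : ℂ) := by
    push_cast
    field_simp
    linear_combination (m : ℂ) ^ 2 * c * Complex.I_sq
  rw [e, Complex.ofReal_re]

theorem summable_exp_neg_sum_sq {c : ℝ} (hc : 0 < c) (n : ℕ) :
    Summable fun m : Fin n → ℤ => Real.exp (-c * ∑ i, (m i : ℝ) ^ 2) := by
  induction n with
  | zero => exact Summable.of_finite
  | succ n ih =>
    rw [← (Fin.consEquiv fun _ => ℤ).summable_iff]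
    refine ((summable_exp_neg_sq hc).mul_of_nonneg ih (fun _ => (Real.exp_pos _).le)
      fun _ => (Real.exp_pos _).le).congr fun p => ?_
    simp [Fin.consEquiv, Fin.sum_univ_succ, ← Real.exp_add, mul_add]

/-- Gaussian series with polynomial weights and arbitrary shifts converge. -/
theorem summable_pow_mul_exp_neg {n : ℕ} {c : ℝ} (hc : 0 < c) (u : Fin n → ℝ) (k : ℕ) :
    Summable fun m : Fin n → ℤ => ‖fun i => (m i : ℝ) + u i‖ ^ k *
      Real.exp (-c * ∑ i, ((m i : ℝ) + u i) ^ 2) := by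
  -- Half of the Gaussian absorbs the polynomial weight, by `t^k ≤ k! e^t` and completing the
  -- square; the other half gives convergence.
  obtain ⟨C, hC⟩ : ∃ C : ℝ, ∀ t : ℝ, 0 ≤ t → t ^ k * Real.exp (-(c / 2) * t ^ 2) ≤ C := by
    have hb : ∀ t : ℝ, 0 ≤ t → t ^ k * Real.exp (-(c / 2) * t ^ 2) ≤
        k.factorial * Real.exp (1 / (2 * c)) := by
      intro t ht
      have h1 : t ^ k ≤ k.factorial * Real.exp t := by
        have := Real.pow_div_factorial_le_exp t ht k
        rwa [div_le_iff₀ (by positivity), mul_comm] at this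
      have h2 : t + -(c / 2) * t ^ 2 ≤ 1 / (2 * c) := by
        rw [le_div_iff₀ (by positivity)]
        nlinarith [sq_nonneg (c * t - 1)]
      calc t ^ k * Real.exp (-(c / 2) * t ^ 2)
          ≤ k.factorial * Real.exp t * Real.exp (-(c / 2) * t ^ 2) := by gcongr
        _ = k.factorial * Real.exp (t + -(c / 2) * t ^ 2) := by rw [mul_assoc, ← Real.exp_add]
        _ ≤ _ := by gcongr
    exact ⟨_, hb⟩
  have hC0 : 0 ≤ C := le_trans (by positivity) (hC 0 le_rfl)
  refine Summable.of_nonneg_of_le (fun _ => by positivity) (fun m => ?_)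
    ((summable_exp_neg_sum_sq (c := c / 4) (by positivity) n).mul_left
      (C * Real.exp (c / 2 * ∑ i, u i ^ 2)))
  set x : Fin n → ℝ := fun i => (m i : ℝ) + u i with hx
  have h1 : ‖x‖ ^ 2 ≤ ∑ i, x i ^ 2 := by
    rcases isEmpty_or_nonempty (Fin n) with he | hne
    · simp [Subsingleton.elim x 0]
    · obtain ⟨i, hi⟩ := Finite.exists_max fun i => ‖x i‖
      refine (pow_le_pow_left₀ (norm_nonneg _)
        ((pi_norm_le_iff_of_nonneg (norm_nonneg _)).mpr hi) 2).trans ?_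
      rw [Real.norm_eq_abs, sq_abs]
      exact Finset.single_le_sum (f := fun i => x i ^ 2) (fun _ _ => sq_nonneg _) (Finset.mem_univ i)
  -- The shift is removed by `m² ≤ 2 (m + u)² + 2 u²`, at the cost of halving the constant again.
  have h2 : -(c / 2) * ∑ i, x i ^ 2 ≤
      c / 2 * ∑ i, u i ^ 2 + -(c / 4) * ∑ i, (m i : ℝ) ^ 2 := by
    have h3 : ∑ i, (m i : ℝ) ^ 2 ≤ ∑ i, (2 * x i ^ 2 + 2 * u i ^ 2) :=
      Finset.sum_le_sum fun i _ => by simp only [hx]; nlinarith [sq_nonneg ((m i : ℝ) + 2 * u i)]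
    rw [Finset.sum_add_distrib, ← Finset.mul_sum, ← Finset.mul_sum] at h3
    nlinarith
  calc ‖x‖ ^ k * Real.exp (-c * ∑ i, x i ^ 2)
      = ‖x‖ ^ k * Real.exp (-(c / 2) * ∑ i, x i ^ 2) * Real.exp (-(c / 2) * ∑ i, x i ^ 2) := by
        rw [mul_assoc, ← Real.exp_add]; congr 2; ring
    _ ≤ ‖x‖ ^ k * Real.exp (-(c / 2) * ‖x‖ ^ 2) * Real.exp (c / 2 * ∑ i, u i ^ 2 +
          -(c / 4) * ∑ i, (m i : ℝ) ^ 2) := by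
        have h4 : -(c / 2) * ∑ i, x i ^ 2 ≤ -(c / 2) * ‖x‖ ^ 2 := by nlinarith
        gcongr
    _ ≤ C * Real.exp (c / 2 * ∑ i, u i ^ 2 + -(c / 4) * ∑ i, (m i : ℝ) ^ 2) := by
        gcongr
        exact hC _ (norm_nonneg _)
    _ = _ := by rw [Real.exp_add]; ring

theorem summable_exp_neg_pi_quadratic {n : ℕ} {y : Matrix (Fin n) (Fin n) ℝ} (hy : y.PosDef)
    (u : Fin n → ℝ) :
    Summable fun m : Fin n → ℤ => Real.exp (-Real.pi *
      ((fun i => (m i : ℝ) - u i) ⬝ᵥ y *ᵥ fun i => (m i : ℝ) - u i)) := by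
  obtain ⟨c, hc, hcy⟩ := exists_lower_bound hy
  refine Summable.of_nonneg_of_le (fun _ => (Real.exp_pos _).le) (fun m => ?_)
    (summable_pow_mul_exp_neg (mul_pos Real.pi_pos hc) (-u) 0)
  rw [pow_zero, one_mul, Real.exp_le_exp]
  have := mul_le_mul_of_nonneg_left (hcy fun i => (m i : ℝ) - u i) Real.pi_pos.le
  simp only [Pi.neg_apply, ← sub_eq_add_neg]
  linarith

end Summability

/-! ## Poisson summation -/

section Poisson

variable {n : ℕ}

/-- The Schur complement of the upper left entry. -/
def schur (y : Matrix (Fin (n + 1)) (Fin (n + 1)) ℝ) : Matrix (Fin n) (Fin n) ℝ :=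
  Matrix.of fun i j => y i.succ j.succ - y 0 i.succ * y 0 j.succ / y 0 0

theorem quadratic_cons {y : Matrix (Fin (n + 1)) (Fin (n + 1)) ℝ} (hy : y.IsSymm) (s : ℝ)
    (x : Fin n → ℝ) :
    (Fin.cons s x : Fin (n + 1) → ℝ) ⬝ᵥ y *ᵥ (Fin.cons s x : Fin (n + 1) → ℝ) =
      y 0 0 * s ^ 2 + 2 * s * (∑ i, y 0 i.succ * x i) +
        x ⬝ᵥ (y.submatrix Fin.succ Fin.succ) *ᵥ x := by
  have h : ∀ i : Fin n, y i.succ 0 = y 0 i.succ := fun i => hy.apply 0 i.succ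
  simp only [dotProduct, Matrix.mulVec, Fin.sum_univ_succ, Fin.cons_zero, Fin.cons_succ,
    Matrix.submatrix_apply, h, mul_add, Finset.sum_add_distrib]
  have : ∑ i, x i * (y 0 i.succ * s) = s * ∑ i, y 0 i.succ * x i := by
    rw [Finset.mul_sum]; exact Finset.sum_congr rfl fun i _ => by ring
  rw [this]; ring

theorem quadratic_schur (y : Matrix (Fin (n + 1)) (Fin (n + 1)) ℝ) (x : Fin n → ℝ) :
    x ⬝ᵥ schur y *ᵥ x = x ⬝ᵥ (y.submatrix Fin.succ Fin.succ) *ᵥ x -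
      (∑ i, y 0 i.succ * x i) ^ 2 / y 0 0 := by
  simp only [dotProduct, Matrix.mulVec, schur, Matrix.of_apply, Matrix.submatrix_apply, sub_mul,
    Finset.sum_sub_distrib, mul_sub]
  congr 1
  rw [sq, Finset.sum_mul_sum, Finset.sum_div]
  refine Finset.sum_congr rfl fun i _ => ?_
  rw [Finset.mul_sum, Finset.sum_div]
  exact Finset.sum_congr rfl fun j _ => by ring

theorem posDef_zero_zero {y : Matrix (Fin (n + 1)) (Fin (n + 1)) ℝ} (hy : y.PosDef) :
    0 < y 0 0 := hy.diag_pos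

theorem posDef_schur {y : Matrix (Fin (n + 1)) (Fin (n + 1)) ℝ} (hy : y.PosDef) :
    (schur y).PosDef := by
  have ha := posDef_zero_zero hy
  obtain ⟨hs, hp⟩ := posDef_iff_real.mp hy
  refine posDef_iff_real.mpr ⟨?_, fun x hx => ?_⟩
  · ext i j
    simp only [schur, Matrix.transpose_apply, Matrix.of_apply, hs.apply j.succ i.succ]
    ring
  -- The first coordinate is chosen to minimise the quadratic form of `y`; the minimum is the value
  -- of the Schur complement at `x`.
  · have hne : (Fin.cons (-(∑ i, y 0 i.succ * x i) / y 0 0) x : Fin (n + 1) → ℝ) ≠ 0 :=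
      fun h => hx (by funext i; simpa using congrFun h i.succ)
    have := hp _ hne
    rw [quadratic_cons hs] at this
    rw [quadratic_schur]
    convert this using 1
    field_simp
    ring

/-- Subtracting multiples of the first row clears the first column below the corner; the entry `c 0
= 0` leaves the first row alone. -/
theorem det_eq_mul_det_schur {y : Matrix (Fin (n + 1)) (Fin (n + 1)) ℝ} (hy : y.PosDef) :
    y.det = y 0 0 * (schur y).det := by
  have ha := (posDef_zero_zero hy).ne'
  have hs := (posDef_iff_real.mp hy).1
  set c : Fin (n + 1) → ℝ := Fin.cons 0 fun i => y 0 i.succ / y 0 0 with hc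
  set B : Matrix (Fin (n + 1)) (Fin (n + 1)) ℝ := Matrix.of fun i j => y i j - c i * y 0 j with hB
  have hdet : y.det = B.det :=
    Matrix.det_eq_of_forall_row_eq_smul_add_const c 0 (by simp [hc]) fun i j => by
      simp [hB, hc]
  rw [hdet, Matrix.det_succ_column_zero, Fin.sum_univ_succ]
  have h0 : ∀ i : Fin n, B i.succ 0 = 0 := fun i => by
    simp [hB, hc, hs.apply 0 i.succ, ha]
  have h1 : B.submatrix (Fin.succAbove 0) Fin.succ = schur y := by
    ext i j
    simp [hB, hc, schur]
    ring
  simp only [h0, h1]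
  simp [hB, hc]

/-- Block elimination: `(z₀, z)` below is the solution of `y (z₀, z) = (s, x)`, with `z` found from
the Schur complement. -/
theorem quadratic_inv_cons {y : Matrix (Fin (n + 1)) (Fin (n + 1)) ℝ} (hy : y.PosDef)
    (s : ℝ) (x : Fin n → ℝ) :
    (Fin.cons s x : Fin (n + 1) → ℝ) ⬝ᵥ y⁻¹ *ᵥ (Fin.cons s x : Fin (n + 1) → ℝ) =
      s ^ 2 / y 0 0 + (fun i => x i - y 0 i.succ * s / y 0 0) ⬝ᵥ
        (schur y)⁻¹ *ᵥ (fun i => x i - y 0 i.succ * s / y 0 0) := by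
  have ha := (posDef_zero_zero hy).ne'
  have hs := (posDef_iff_real.mp hy).1
  have hu : IsUnit y.det := hy.det_pos.ne'.isUnit
  have hu' : IsUnit (schur y).det := (posDef_schur hy).det_pos.ne'.isUnit
  set v : Fin n → ℝ := fun i => x i - y 0 i.succ * s / y 0 0 with hv
  set z := (schur y)⁻¹ *ᵥ v with hz
  have hSz : schur y *ᵥ z = v := by
    rw [hz, Matrix.mulVec_mulVec, Matrix.mul_nonsing_inv _ hu', Matrix.one_mulVec]
  set z₀ := (s - ∑ i, y 0 i.succ * z i) / y 0 0 with hz₀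
  have hyz : y *ᵥ (Fin.cons z₀ z : Fin (n + 1) → ℝ) = Fin.cons s x := by
    funext i
    refine Fin.cases ?_ (fun i => ?_) i
    · simp only [Matrix.mulVec, dotProduct, Fin.sum_univ_succ, Fin.cons_zero, Fin.cons_succ, hz₀]
      field_simp
      ring
    · have := congrFun hSz i
      simp only [Matrix.mulVec, dotProduct, schur, Matrix.of_apply, sub_mul,
        Finset.sum_sub_distrib, hv] at this
      have e : ∑ j, y 0 i.succ * y 0 j.succ / y 0 0 * z j =
          y 0 i.succ / y 0 0 * ∑ j, y 0 j.succ * z j := by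
        rw [Finset.mul_sum]; exact Finset.sum_congr rfl fun j _ => by ring
      rw [e] at this
      simp only [Matrix.mulVec, dotProduct, Fin.sum_univ_succ, Fin.cons_zero, Fin.cons_succ, hz₀,
        hs.apply 0 i.succ]
      linear_combination this
  have hinv : y⁻¹ *ᵥ (Fin.cons s x : Fin (n + 1) → ℝ) = Fin.cons z₀ z := by
    rw [← hyz, Matrix.mulVec_mulVec, Matrix.nonsing_inv_mul _ hu, Matrix.one_mulVec]
  rw [hinv]
  simp only [dotProduct, Fin.sum_univ_succ, Fin.cons_zero, Fin.cons_succ, hv, sub_mul,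
    Finset.sum_sub_distrib, hz₀]
  have e : ∑ i, y 0 i.succ * s / y 0 0 * z i = s / y 0 0 * ∑ i, y 0 i.succ * z i := by
    rw [Finset.mul_sum]; exact Finset.sum_congr rfl fun j _ => by ring
  rw [e]; ring

/-- In the induction on dimension, `β` comes from the mixed terms of the quadratic form and `w` from
the character. -/
theorem tsum_exp_neg_quadratic_one {a : ℝ} (ha : 0 < a) (β w : ℝ) :
    ∑' p : ℤ, Complex.exp (-Real.pi * (a * p ^ 2 + 2 * p * β) + 2 * Real.pi * Complex.I * (p * w)) =
      ((√a)⁻¹ : ℝ) * ∑' k : ℤ, Complex.exp (-Real.pi * (((k : ℂ) - w) ^ 2 / a - β ^ 2 / a) +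
        2 * Real.pi * Complex.I * (β * (k - w) / a)) := by
  have h := Complex.tsum_exp_neg_quadratic (a := a) (by simpa using ha)
    (-β + Complex.I * w)
  have hs : (a : ℂ) ^ (1 / 2 : ℂ) = ((√a : ℝ) : ℂ) := by
    rw [Real.sqrt_eq_rpow, Complex.ofReal_cpow ha.le]; norm_num
  have ha' : (a : ℂ) ≠ 0 := by exact_mod_cast ha.ne'
  rw [hs] at h
  rw [Complex.ofReal_inv, inv_eq_one_div]
  refine Eq.trans (tsum_congr fun p => ?_) (h.trans (congrArg _ (tsum_congr fun k => ?_)))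
  · congr 1; ring
  · congr 1
    field_simp
    ring_nf
    simp [show Complex.I ^ 3 = -Complex.I by rw [pow_succ, Complex.I_sq]; ring,
      show Complex.I ^ 4 = 1 by rw [show 4 = 2 * 2 by rfl, pow_mul, Complex.I_sq]; norm_num]
    ring

theorem tsum_fin_succ {α : Type*} [NormedAddCommGroup α] [CompleteSpace α]
    {f : (Fin (n + 1) → ℤ) → α} (hf : Summable f) :
    ∑' p, f p = ∑' (a : ℤ) (p : Fin n → ℤ), f (Fin.cons a p) := by
  rw [← (Fin.consEquiv fun _ => ℤ).summable_iff] at hf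
  rw [← (Fin.consEquiv fun _ => ℤ).tsum_eq]
  exact hf.tsum_prod

theorem tsum_fin_succ' {α : Type*} [NormedAddCommGroup α] [CompleteSpace α]
    {f : (Fin (n + 1) → ℤ) → α} (hf : Summable f) :
    ∑' p, f p = ∑' (p : Fin n → ℤ) (a : ℤ), f (Fin.cons a p) := by
  rw [tsum_fin_succ hf]
  rw [← (Fin.consEquiv fun _ => ℤ).summable_iff] at hf
  exact (Summable.tsum_comm (f := fun a p => f (Fin.cons a p)) hf).symm

/-- Poisson summation for a Gaussian on `ℝⁿ`. -/
theorem tsum_exp_neg_pi_quadratic {n : ℕ} {y : Matrix (Fin n) (Fin n) ℝ} (hy : y.PosDef)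
    (w : Fin n → ℝ) :
    ∑' p : Fin n → ℤ, Complex.exp
        ((-Real.pi * ((fun i => (p i : ℝ)) ⬝ᵥ y *ᵥ fun i => (p i : ℝ)) : ℝ) +
          2 * Real.pi * Complex.I * ((∑ i, (p i : ℝ) * w i : ℝ) : ℂ)) =
      ((√y.det)⁻¹ * ∑' k : Fin n → ℤ, Real.exp (-Real.pi *
        ((fun i => (k i : ℝ) - w i) ⬝ᵥ y⁻¹ *ᵥ fun i => (k i : ℝ) - w i)) : ℝ) := by
  induction n with
  | zero => simp [tsum_fintype]
  | succ n ih =>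
    have ha := posDef_zero_zero hy
    have hs := (posDef_iff_real.mp hy).1
    have hS := posDef_schur hy
    set a := y 0 0 with ha_def
    set S := schur y with hS_def
    set b : Fin n → ℝ := fun i => y 0 i.succ with hb
    -- After the first Poisson summation the mixed term leaves the phase `β (k - w 0) / a` with `β =
    -- ∑ b i * p i`. It is linear in the remaining `p`, so it shifts their character.
    set w' : ℤ → Fin n → ℝ := fun k i => w i.succ + b i * (k - w 0) / a with hw'
    -- the summand after Poisson summation in the first variable
    set f : (Fin n → ℤ) → ℤ → ℂ := fun p k =>
      ((Real.exp (-Real.pi * ((k - w 0) ^ 2 / a)) : ℝ) : ℂ) * Complex.exp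
        ((-Real.pi * ((fun i => (p i : ℝ)) ⬝ᵥ S *ᵥ fun i => (p i : ℝ)) : ℝ) +
          2 * Real.pi * Complex.I * ((∑ i, (p i : ℝ) * w' k i : ℝ) : ℂ)) with hf
    have hsum1 : Summable fun p : Fin n → ℤ => Real.exp (-Real.pi *
        ((fun i => (p i : ℝ)) ⬝ᵥ S *ᵥ fun i => (p i : ℝ))) := by
      simpa using summable_exp_neg_pi_quadratic hS 0
    have hsum2 : Summable fun k : ℤ => Real.exp (-Real.pi * (((k : ℝ) - w 0) ^ 2 / a)) := by
      have h := summable_pow_mul_exp_neg (n := 1) (c := Real.pi / a) (by positivity)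
        (fun _ => -w 0) 0
      rw [← (Equiv.funUnique (Fin 1) ℤ).symm.summable_iff] at h
      refine h.congr fun k => ?_
      simp
      ring_nf
    -- After the first summation the phases have absolute value one and the moduli split as a
    -- product, which justifies exchanging the sums over `p` and `k`.
    have hfs : Summable (Function.uncurry f) := by
      refine Summable.of_norm ((hsum1.mul_of_nonneg hsum2 (fun _ => (Real.exp_pos _).le)
        fun _ => (Real.exp_pos _).le).congr fun x => ?_)
      simp only [hf, Function.uncurry, norm_mul, Complex.norm_real, Real.norm_eq_abs, Real.abs_exp,
        Complex.norm_exp, Complex.add_re, Complex.ofReal_re]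
      rw [mul_comm]
      simp
    have hterm : ∀ (p₀ : ℤ) (p : Fin n → ℤ), Complex.exp
        ((-Real.pi * ((fun i => ((Fin.cons p₀ p : Fin (n + 1) → ℤ) i : ℝ)) ⬝ᵥ y *ᵥ
            fun i => ((Fin.cons p₀ p : Fin (n + 1) → ℤ) i : ℝ)) : ℝ) +
          2 * Real.pi * Complex.I *
            ((∑ i, ((Fin.cons p₀ p : Fin (n + 1) → ℤ) i : ℝ) * w i : ℝ) : ℂ)) =
        Complex.exp ((-Real.pi * ((fun i => (p i : ℝ)) ⬝ᵥ
            (y.submatrix Fin.succ Fin.succ) *ᵥ fun i => (p i : ℝ)) : ℝ) +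
          2 * Real.pi * Complex.I * ((∑ i, (p i : ℝ) * w i.succ : ℝ) : ℂ)) *
        Complex.exp (-Real.pi * (a * p₀ ^ 2 + 2 * p₀ * (∑ i, b i * p i : ℝ)) +
          2 * Real.pi * Complex.I * (p₀ * w 0)) := by
      intro p₀ p
      have e : (fun i => ((Fin.cons p₀ p : Fin (n + 1) → ℤ) i : ℝ)) =
          (Fin.cons (p₀ : ℝ) (fun i => (p i : ℝ)) : Fin (n + 1) → ℝ) := by
        funext i; refine Fin.cases ?_ (fun i => ?_) i <;> simp
      rw [e, quadratic_cons hs, ← Complex.exp_add, Fin.sum_univ_succ]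
      congr 1
      simp only [Fin.cons_zero, Fin.cons_succ]
      push_cast
      ring
    have hfirst : ∀ p : Fin n → ℤ, ∑' p₀ : ℤ, Complex.exp
        ((-Real.pi * ((fun i => ((Fin.cons p₀ p : Fin (n + 1) → ℤ) i : ℝ)) ⬝ᵥ y *ᵥ
            fun i => ((Fin.cons p₀ p : Fin (n + 1) → ℤ) i : ℝ)) : ℝ) +
          2 * Real.pi * Complex.I *
            ((∑ i, ((Fin.cons p₀ p : Fin (n + 1) → ℤ) i : ℝ) * w i : ℝ) : ℂ)) =
        ((√a)⁻¹ : ℝ) * ∑' k, f p k := by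
      intro p
      simp only [hterm]
      rw [tsum_mul_left, tsum_exp_neg_quadratic_one ha, mul_left_comm, ← tsum_mul_left]
      congr 1
      refine tsum_congr fun k => ?_
      simp only [hf]
      -- The term `β² / a` produced by the one-variable formula turns the lower right block of `y`
      -- into its Schur complement, as the induction hypothesis needs.
      rw [← Complex.exp_add, Complex.ofReal_exp, ← Complex.exp_add, quadratic_schur]
      congr 1
      have e : ∑ i, (p i : ℝ) * w' k i = ∑ i, (p i : ℝ) * w i.succ +
          (∑ i, b i * p i) * (k - w 0) / a := by
        simp only [hw', mul_add, Finset.sum_add_distrib]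
        rw [Finset.sum_mul, Finset.sum_div]
        congr 1
        exact Finset.sum_congr rfl fun i _ => by ring
      rw [e]
      push_cast
      ring
    have hsumL : Summable fun p : Fin (n + 1) → ℤ => Complex.exp
        ((-Real.pi * ((fun i => (p i : ℝ)) ⬝ᵥ y *ᵥ fun i => (p i : ℝ)) : ℝ) +
          2 * Real.pi * Complex.I * ((∑ i, (p i : ℝ) * w i : ℝ) : ℂ)) := by
      refine Summable.of_norm (Summable.congr (by simpa using summable_exp_neg_pi_quadratic hy 0)
        fun p => ?_)
      rw [Complex.norm_exp]
      simp
    have hR : ∀ k₀ : ℤ, ∑' p, f p k₀ = ((√S.det)⁻¹ : ℝ) * ∑' k : Fin n → ℤ,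
        ((Real.exp (-Real.pi * ((fun i => ((Fin.cons k₀ k : Fin (n + 1) → ℤ) i : ℝ) - w i) ⬝ᵥ
          y⁻¹ *ᵥ fun i => ((Fin.cons k₀ k : Fin (n + 1) → ℤ) i : ℝ) - w i)) : ℝ) : ℂ) := by
      intro k₀
      simp only [hf]
      rw [tsum_mul_left, ih hS, Complex.ofReal_mul, mul_left_comm, Complex.ofReal_tsum,
        ← tsum_mul_left]
      congr 1
      refine tsum_congr fun k => ?_
      have e : (fun i => ((Fin.cons k₀ k : Fin (n + 1) → ℤ) i : ℝ) - w i) =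
          (Fin.cons ((k₀ : ℝ) - w 0) (fun i => (k i : ℝ) - w i.succ) : Fin (n + 1) → ℝ) := by
        funext i; refine Fin.cases ?_ (fun i => ?_) i <;> simp
      rw [e, quadratic_inv_cons hy, ← Complex.ofReal_mul, ← Real.exp_add]
      congr 2
      simp only [hw', sub_add_eq_sub_sub, ← ha_def, ← hS_def]
      ring
    have hsumR := summable_exp_neg_pi_quadratic (y := y⁻¹) hy.inv w
    rw [tsum_fin_succ' hsumL, tsum_fin_succ hsumR, det_eq_mul_det_schur hy, Real.sqrt_mul ha.le]
    simp only [hfirst]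
    rw [tsum_mul_left, ← hfs.tsum_comm]
    simp only [hR]
    rw [tsum_mul_left]
    push_cast
    ring

end Poisson

/-! ### The norm of the vector of theta constants as a lattice sum. -/

section NormSq

variable {g : ℕ}

/-- A real vector as a complex vector. -/
def toC (v : Fin g → ℝ) : Fin g → ℂ := fun i => (v i : ℂ)

@[simp] theorem toC_apply (v : Fin g → ℝ) (i : Fin g) : toC v i = v i := rfl

theorem toC_sub (v w : Fin g → ℝ) : toC (v - w) = toC v - toC w := by
  ext i; simp

theorem star_toC (v : Fin g → ℝ) : star (toC v) = toC v := by
  ext i; simp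

theorem toC_dotProduct (v w : Fin g → ℝ) : toC v ⬝ᵥ toC w = ((v ⬝ᵥ w : ℝ) : ℂ) := by
  simp [dotProduct]

theorem map_mulVec_toC (y : Matrix (Fin g) (Fin g) ℝ) (v : Fin g → ℝ) :
    y.map Complex.ofReal *ᵥ toC v = toC (y *ᵥ v) := by
  ext i; simp [Matrix.mulVec, dotProduct]

theorem mulVec_toC (τ : Matrix (Fin g) (Fin g) ℂ) (v : Fin g → ℝ) :
    τ *ᵥ toC v = toC (τ.map Complex.re *ᵥ v) + Complex.I • toC (τ.map Complex.im *ᵥ v) := by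
  ext i
  simp only [Matrix.mulVec, dotProduct, toC_apply, Pi.add_apply, Pi.smul_apply, smul_eq_mul,
    Complex.ofReal_sum, Complex.ofReal_mul, Matrix.map_apply, Finset.mul_sum]
  rw [← Finset.sum_add_distrib]
  refine Finset.sum_congr rfl fun j _ => ?_
  conv_lhs => rw [← Complex.re_add_im (τ i j)]
  ring

/-- The summand of the second order theta functions at `z = 0`. -/
def thetaTerm (τ : Matrix (Fin g) (Fin g) ℂ) (v : Fin g → ℝ) : ℂ :=
  Complex.exp (2 * Real.pi * Complex.I * (toC v ⬝ᵥ τ *ᵥ toC v))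

theorem secondOrderTheta_zero (u : Fin g → ℝ) (τ : Matrix (Fin g) (Fin g) ℂ) :
    secondOrderTheta u 0 τ = ∑' m : Fin g → ℤ, thetaTerm τ (fun i => m i + u i) := by
  unfold secondOrderTheta thetaTerm
  refine tsum_congr fun m => ?_
  rw [dotProduct_zero, mul_zero, add_zero]
  have : toC (fun i => (m i : ℝ) + u i) = fun i => (m i : ℂ) + (u i : ℂ) := by ext i; simp
  rw [this]

theorem thetaTerm_eq (τ : Matrix (Fin g) (Fin g) ℂ) (v : Fin g → ℝ) :
    thetaTerm τ v = Complex.exp (((-2 * Real.pi * (v ⬝ᵥ τ.map Complex.im *ᵥ v) : ℝ) : ℂ) +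
      2 * Real.pi * Complex.I * ((v ⬝ᵥ τ.map Complex.re *ᵥ v : ℝ) : ℂ)) := by
  rw [thetaTerm, mulVec_toC, dotProduct_add, dotProduct_smul, toC_dotProduct, toC_dotProduct,
    smul_eq_mul]
  congr 1
  push_cast
  linear_combination 2 * Real.pi * ((v ⬝ᵥ τ.map Complex.im *ᵥ v : ℝ) : ℂ) * Complex.I_sq

theorem norm_thetaTerm (τ : Matrix (Fin g) (Fin g) ℂ) (v : Fin g → ℝ) :
    ‖thetaTerm τ v‖ = Real.exp (-2 * Real.pi * (v ⬝ᵥ τ.map Complex.im *ᵥ v)) := by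
  rw [thetaTerm_eq, Complex.norm_exp]
  simp

theorem quadratic_add_sub (y : Matrix (Fin g) (Fin g) ℝ) (p q : Fin g → ℝ) :
    (fun i => (p i + q i) / 2) ⬝ᵥ y *ᵥ (fun i => (p i + q i) / 2) +
      (fun i => (p i - q i) / 2) ⬝ᵥ y *ᵥ (fun i => (p i - q i) / 2) =
    (p ⬝ᵥ y *ᵥ p + q ⬝ᵥ y *ᵥ q) / 2 := by
  have e1 : (fun i => (p i + q i) / 2) = (1 / 2 : ℝ) • (p + q) := by ext i; simp; ring
  have e2 : (fun i => (p i - q i) / 2) = (1 / 2 : ℝ) • (p - q) := by ext i; simp; ring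
  rw [e1, e2, dotProduct_mulVec_smul, dotProduct_mulVec_smul]
  simp only [Matrix.mulVec_add, Matrix.mulVec_sub, add_dotProduct, sub_dotProduct,
    dotProduct_add, dotProduct_sub]
  ring

theorem quadratic_add_sub' {x : Matrix (Fin g) (Fin g) ℝ} (hx : x.IsSymm) (p q : Fin g → ℝ) :
    (fun i => (p i + q i) / 2) ⬝ᵥ x *ᵥ (fun i => (p i + q i) / 2) -
      (fun i => (p i - q i) / 2) ⬝ᵥ x *ᵥ (fun i => (p i - q i) / 2) =
    p ⬝ᵥ x *ᵥ q := by
  have e1 : (fun i => (p i + q i) / 2) = (1 / 2 : ℝ) • (p + q) := by ext i; simp; ring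
  have e2 : (fun i => (p i - q i) / 2) = (1 / 2 : ℝ) • (p - q) := by ext i; simp; ring
  have e3 : q ⬝ᵥ x *ᵥ p = p ⬝ᵥ x *ᵥ q := by
    rw [Matrix.dotProduct_mulVec, ← Matrix.mulVec_transpose, hx.eq, dotProduct_comm]
  rw [e1, e2, dotProduct_mulVec_smul, dotProduct_mulVec_smul]
  simp only [Matrix.mulVec_add, Matrix.mulVec_sub, add_dotProduct, sub_dotProduct,
    dotProduct_add, dotProduct_sub, e3]
  ring

/-- Conjugation flips the sign of the real part's phase only. So the imaginary part enters through
the parallelogram law and the real part through polarisation. -/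
theorem thetaTerm_mul_conj {τ : Matrix (Fin g) (Fin g) ℂ} (hτ : τ.IsSymm) (p q : Fin g → ℝ) :
    thetaTerm τ (fun i => (p i + q i) / 2) *
        (starRingEnd ℂ) (thetaTerm τ (fun i => (p i - q i) / 2)) =
      Real.exp (-Real.pi * (q ⬝ᵥ τ.map Complex.im *ᵥ q)) *
      Complex.exp (((-Real.pi * (p ⬝ᵥ τ.map Complex.im *ᵥ p) : ℝ) : ℂ) +
        2 * Real.pi * Complex.I * ((∑ i, p i * (τ.map Complex.re *ᵥ q) i : ℝ) : ℂ)) := by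
  have hx : (τ.map Complex.re).IsSymm := hτ.map _
  have h1 := quadratic_add_sub (τ.map Complex.im) p q
  have h2 := quadratic_add_sub' hx p q
  rw [thetaTerm_eq, thetaTerm_eq, ← Complex.exp_conj, ← Complex.exp_add, Complex.ofReal_exp,
    ← Complex.exp_add]
  congr 1
  simp only [map_add, map_mul, Complex.conj_ofReal, Complex.conj_I, map_ofNat]
  change _ = _ + (_ + 2 * Real.pi * Complex.I * ((p ⬝ᵥ τ.map Complex.re *ᵥ q : ℝ) : ℂ))
  rw [← h2]
  have h1' := congrArg (fun r : ℝ => (r : ℂ)) h1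
  push_cast at h1' ⊢
  linear_combination (-2 * Real.pi) * h1'

/-- `(α, m, n) ↦ (m + n + α, m - n)`, where `α ∈ {0, 1}^g`. -/
def sumDiffEquiv (g : ℕ) : (Fin g → ZMod 2) × (Fin g → ℤ) × (Fin g → ℤ) ≃
    (Fin g → ℤ) × (Fin g → ℤ) :=
  Equiv.ofBijective
    (fun t => (fun i => t.2.1 i + t.2.2 i + ((t.1 i).val : ℤ), fun i => t.2.1 i - t.2.2 i)) <| by
    constructor
    · rintro ⟨α, m, n⟩ ⟨α', m', n'⟩ h
      have h1 : ∀ i, m i + n i + ((α i).val : ℤ) = m' i + n' i + ((α' i).val : ℤ) :=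
        fun i => congrFun (congrArg Prod.fst h) i
      have h2 : ∀ i, m i - n i = m' i - n' i := fun i => congrFun (congrArg Prod.snd h) i
      have hl : ∀ β : Fin g → ZMod 2, ∀ i, (β i).val < 2 := fun β i => ZMod.val_lt _
      have h3 : ∀ i, (α i).val = (α' i).val ∧ m i = m' i ∧ n i = n' i := fun i => by
        have := h1 i; have := h2 i; have := hl α i; have := hl α' i
        omega
      refine Prod.ext (funext fun i => ZMod.val_injective 2 (h3 i).1)
        (Prod.ext (funext fun i => (h3 i).2.1) (funext fun i => (h3 i).2.2))
    · rintro ⟨p, q⟩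
      -- From `p - q = 2n + α`, the class `α` is the parity of `p - q` and `n` is the floor of its
      -- half; then `m = n + q`.
      refine ⟨(fun i => ((p i - q i : ℤ) : ZMod 2), fun i => (p i - q i) / 2 + q i,
        fun i => (p i - q i) / 2), ?_⟩
      refine Prod.ext (funext fun i => ?_) (funext fun i => ?_)
      · simp only [ZMod.val_intCast]
        push_cast
        omega
      · simp

theorem sumDiffEquiv_apply (α : Fin g → ZMod 2) (m n : Fin g → ℤ) :
    sumDiffEquiv g (α, m, n) =
      (fun i => m i + n i + ((α i).val : ℤ), fun i => m i - n i) := rfl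

/-- The positive definite quadratic form `|k - τ q|²` on `ℝ^{2g}`, where the norm is that of
`(Im τ)⁻¹`. -/
def majorant (τ : Matrix (Fin g) (Fin g) ℂ) (k q : Fin g → ℝ) : ℝ :=
  (k - τ.map Complex.re *ᵥ q) ⬝ᵥ (τ.map Complex.im)⁻¹ *ᵥ (k - τ.map Complex.re *ᵥ q) +
    q ⬝ᵥ τ.map Complex.im *ᵥ q

/-- An integral vector as a real vector. -/
def intVec (m : Fin g → ℤ) : Fin g → ℝ := fun i => m i

/-- The true exponent has the factor `2π`; the bound with `π` suffices because the quadratic form is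
nonnegative. -/
theorem summable_thetaTerm {τ : Matrix (Fin g) (Fin g) ℂ} (hτ : IsSiegel τ) (u : Fin g → ℝ) :
    Summable fun m : Fin g → ℤ => ‖thetaTerm τ (fun i => m i + u i)‖ := by
  refine Summable.of_nonneg_of_le (fun _ => norm_nonneg _) (fun m => ?_)
    (summable_exp_neg_pi_quadratic hτ.2 (-u))
  rw [norm_thetaTerm, Real.exp_le_exp]
  have h := hτ.2.posSemidef.dotProduct_mulVec_nonneg fun i => (m i : ℝ) + u i
  simp only [star_trivial] at h
  simp only [Pi.neg_apply, sub_neg_eq_add]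
  nlinarith [Real.pi_pos]

/-- Expand the squares, reindex by `sumDiffEquiv`, and apply Poisson summation in `p` for fixed `q`,
with character `x q`. Summability is carried along because both the passage to a double sum and the
later positivity argument require it. -/
theorem summable_exp_majorant_and_normSq {τ : SymMat g} (hτ : τ ∈ siegelSet g) :
    (Summable fun v : (Fin g → ℤ) × (Fin g → ℤ) =>
      Real.exp (-Real.pi * majorant τ.toMatrix (intVec v.2) (intVec v.1))) ∧
    ‖thetaNull τ‖ ^ 2 = (√(τ.toMatrix.map Complex.im).det)⁻¹ *
      ∑' v : (Fin g → ℤ) × (Fin g → ℤ),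
        Real.exp (-Real.pi * majorant τ.toMatrix (intVec v.2) (intVec v.1)) := by
  obtain ⟨hs, hy⟩ := hτ
  have hS : IsSiegel τ.toMatrix := ⟨hs, hy⟩
  set T := τ.toMatrix with hT
  set y := T.map Complex.im with hy_def
  set x := T.map Complex.re with hx_def
  set K : (Fin g → ℤ) × (Fin g → ℤ) → ℂ := fun v =>
    Real.exp (-Real.pi * (intVec v.2 ⬝ᵥ y *ᵥ intVec v.2)) *
      Complex.exp (((-Real.pi * (intVec v.1 ⬝ᵥ y *ᵥ intVec v.1) : ℝ) : ℂ) +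
        2 * Real.pi * Complex.I * ((∑ i, intVec v.1 i * (x *ᵥ intVec v.2) i : ℝ) : ℂ)) with hK_def
  have hgauss : Summable fun p : Fin g → ℤ => Real.exp (-Real.pi * (intVec p ⬝ᵥ y *ᵥ intVec p)) := by
    refine (summable_exp_neg_pi_quadratic hy 0).congr fun p => ?_
    simp only [Pi.zero_apply, sub_zero]
    rfl
  have hK : Summable K := by
    refine Summable.of_norm ((hgauss.mul_of_nonneg hgauss (fun _ => (Real.exp_pos _).le)
      fun _ => (Real.exp_pos _).le).congr fun v => ?_)
    simp only [hK_def, norm_mul, Complex.norm_real, Real.norm_eq_abs, Real.abs_exp,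
      Complex.norm_exp, Complex.add_re, Complex.ofReal_re]
    rw [mul_comm]
    simp
  have hinner : ∀ q : Fin g → ℤ, ∑' p, K (p, q) = (((√y.det)⁻¹ * ∑' k : Fin g → ℤ,
      Real.exp (-Real.pi * majorant T (intVec k) (intVec q)) : ℝ) : ℂ) := by
    intro q
    simp only [hK_def]
    rw [tsum_mul_left]
    have h := tsum_exp_neg_pi_quadratic hy (x *ᵥ intVec q)
    change ∑' p : Fin g → ℤ, Complex.exp
      (((-Real.pi * (intVec p ⬝ᵥ y *ᵥ intVec p) : ℝ) : ℂ) + 2 * Real.pi * Complex.I *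
        ((∑ i, intVec p i * (x *ᵥ intVec q) i : ℝ) : ℂ)) = _ at h
    rw [h, ← Complex.ofReal_mul, mul_left_comm, ← tsum_mul_left]
    congr 2
    refine tsum_congr fun k => ?_
    rw [← Real.exp_add, majorant]
    congr 1
    change _ + -Real.pi * ((intVec k - x *ᵥ intVec q) ⬝ᵥ y⁻¹ *ᵥ (intVec k - x *ᵥ intVec q)) = _
    ring
  have hdet : 0 < √y.det := Real.sqrt_pos.mpr hy.det_pos
  have hnorm : ((‖thetaNull τ‖ ^ 2 : ℝ) : ℂ) = ∑' v, K v := by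
    have hKe : Summable fun t => K (sumDiffEquiv g t) := (sumDiffEquiv g).summable_iff.mpr hK
    rw [← (sumDiffEquiv g).tsum_eq, hKe.tsum_prod, tsum_fintype, EuclideanSpace.norm_sq_eq]
    push_cast
    refine Finset.sum_congr rfl fun α _ => ?_
    have hsum := summable_thetaTerm hS (halfRep α)
    have hsum' : Summable fun m : Fin g → ℤ =>
        ‖(starRingEnd ℂ) (thetaTerm T (fun i => m i + halfRep α i))‖ := by
      simpa only [RCLike.norm_conj] using hsum
    have hval : thetaNull τ α = ∑' m : Fin g → ℤ, thetaTerm T (fun i => m i + halfRep α i) :=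
      secondOrderTheta_zero _ _
    rw [← Complex.mul_conj', hval, Complex.conj_tsum, tsum_mul_tsum_of_summable_norm hsum hsum']
    refine tsum_congr fun mn => ?_
    have h := thetaTerm_mul_conj hs (intVec (sumDiffEquiv g (α, mn)).1)
      (intVec (sumDiffEquiv g (α, mn)).2)
    refine Eq.trans ?_ h
    obtain ⟨m, n⟩ := mn
    rw [sumDiffEquiv_apply]
    congr 3
    · funext i; simp [intVec, halfRep]; ring
    · funext i; simp [intVec, halfRep]; ring
  have hKc : Summable fun t => K (Equiv.prodComm _ _ t) := (Equiv.prodComm _ _).summable_iff.mpr hK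
  have hKs : Summable fun q : Fin g → ℤ => ∑' p, K (p, q) := hKc.prod
  have hsummable : Summable fun v : (Fin g → ℤ) × (Fin g → ℤ) =>
      Real.exp (-Real.pi * majorant T (intVec v.2) (intVec v.1)) := by
    refine (summable_prod_of_nonneg fun _ => (Real.exp_pos _).le).mpr ⟨fun q => ?_, ?_⟩
    · refine ((summable_exp_neg_pi_quadratic hy.inv (x *ᵥ intVec q)).mul_left
        (Real.exp (-Real.pi * (intVec q ⬝ᵥ y *ᵥ intVec q)))).congr fun k => ?_
      rw [← Real.exp_add, majorant]
      congr 1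
      change _ + -Real.pi * ((intVec k - x *ᵥ intVec q) ⬝ᵥ y⁻¹ *ᵥ (intVec k - x *ᵥ intVec q)) = _
      ring
    -- No estimate is needed: up to the factor `√(det y)`, the sums over `k` are the sums over `p`
    -- of the absolutely convergent series `K`.
    · simp only [hinner] at hKs
      have h := (Complex.summable_ofReal.mp hKs).mul_left (√y.det)
      refine h.congr fun q => ?_
      rw [← mul_assoc, mul_inv_cancel₀ hdet.ne', one_mul]
  refine ⟨hsummable, ?_⟩
  rw [← Complex.ofReal_inj, hnorm, hsummable.tsum_prod, ← (Equiv.prodComm _ _).tsum_eq,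
    hKc.tsum_prod, ← tsum_mul_left, Complex.ofReal_tsum]
  exact tsum_congr hinner

theorem thetaNull_ne_zero {τ : SymMat g} (hτ : τ ∈ siegelSet g) : thetaNull τ ≠ 0 := by
  obtain ⟨h1, h2⟩ := summable_exp_majorant_and_normSq hτ
  have h3 := h1.tsum_pos (fun _ => (Real.exp_pos _).le) 0 (Real.exp_pos _)
  have h4 := mul_pos (inv_pos.mpr (Real.sqrt_pos.mpr hτ.2.det_pos)) h3
  rw [← h2] at h4
  intro h0
  simp [h0] at h4

/-! ### Invariance under the symplectic group -/

/-- Here `k - τq = A - i y q` with `A = k - x q`, so `z = y⁻¹A - i q` and the cross terms cancel.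
The real form thus becomes the Hermitian form of `y⁻¹` at `k - τq`, which transforms simply. Taking
`z` as a solution of a linear system avoids inverting complex matrices later. -/
theorem majorant_eq {τ : Matrix (Fin g) (Fin g) ℂ} (hy : (τ.map Complex.im).PosDef)
    (k q : Fin g → ℝ) {z : Fin g → ℂ}
    (hz : (τ.map Complex.im).map Complex.ofReal *ᵥ z = toC k - τ *ᵥ toC q) :
    ((majorant τ k q : ℝ) : ℂ) = star (toC k - τ *ᵥ toC q) ⬝ᵥ z := by
  have hu : IsUnit (τ.map Complex.im).det := hy.det_pos.ne'.isUnit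
  have hs := (posDef_iff_real.mp hy).1
  rw [majorant]
  rw [mulVec_toC, ← sub_sub, ← toC_sub] at hz ⊢
  set y := τ.map Complex.im
  set A := k - τ.map Complex.re *ᵥ q
  have hyA : y *ᵥ (y⁻¹ *ᵥ A) = A := by
    rw [Matrix.mulVec_mulVec, Matrix.mul_nonsing_inv _ hu, Matrix.one_mulVec]
  have hz' : z = toC (y⁻¹ *ᵥ A) - Complex.I • toC q := by
    have hinj : ∀ v w : Fin g → ℂ, y.map Complex.ofReal *ᵥ v = y.map Complex.ofReal *ᵥ w → v = w := by
      intro v w h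
      have hu' : IsUnit (y.map Complex.ofReal).det := by
        have : (y.map Complex.ofReal).det = ((y.det : ℝ) : ℂ) :=
          (RingHom.map_det Complex.ofRealHom y).symm
        rw [this]
        exact (Complex.ofReal_ne_zero.mpr hy.det_pos.ne').isUnit
      have := congrArg (fun v => (y.map Complex.ofReal)⁻¹ *ᵥ v) h
      simpa [Matrix.mulVec_mulVec, Matrix.nonsing_inv_mul _ hu'] using this
    refine hinj _ _ ?_
    rw [hz, Matrix.mulVec_sub, Matrix.mulVec_smul, map_mulVec_toC, map_mulVec_toC, hyA]
  have e : (y *ᵥ q) ⬝ᵥ (y⁻¹ *ᵥ A) = A ⬝ᵥ q := by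
    rw [Matrix.dotProduct_mulVec, ← Matrix.mulVec_transpose, Matrix.transpose_nonsing_inv, hs.eq,
      Matrix.mulVec_mulVec, Matrix.nonsing_inv_mul _ hu, Matrix.one_mulVec, dotProduct_comm]
  have e' : (y *ᵥ q) ⬝ᵥ q = q ⬝ᵥ y *ᵥ q := dotProduct_comm _ _
  rw [hz', star_sub, star_smul, star_toC, star_toC, Complex.star_def, Complex.conj_I]
  simp only [sub_dotProduct, dotProduct_sub, smul_dotProduct, dotProduct_smul, toC_dotProduct,
    smul_eq_mul, e, e']
  push_cast
  linear_combination ((q ⬝ᵥ y *ᵥ q : ℝ) : ℂ) * Complex.I_sq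

theorem sub_conjTranspose {τ : Matrix (Fin g) (Fin g) ℂ} (hτ : τ.IsSymm) :
    τ - τᴴ = (2 * Complex.I) • (τ.map Complex.im).map Complex.ofReal := by
  ext i j
  simp only [Matrix.sub_apply, Matrix.conjTranspose_apply, hτ.apply i j, Matrix.smul_apply,
    Matrix.map_apply, smul_eq_mul, Complex.star_def, Complex.sub_conj]
  push_cast; ring

/-- `(c τ + d)^* Im(M τ) (c τ + d) = Im τ`. -/
theorem im_smul (M : Sp g) (τ : SiegelSpace g) :
    (den M τ.1.toMatrix)ᴴ * ((M • τ).1.toMatrix.map Complex.im).map Complex.ofReal *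
      den M τ.1.toMatrix = (τ.1.toMatrix.map Complex.im).map Complex.ofReal := by
  have hu := isUnit_den M τ.2
  have hnum : (M • τ).1.toMatrix * den M τ.1.toMatrix = num M τ.1.toMatrix := by
    rw [coe_smul, Matrix.mul_assoc, Matrix.nonsing_inv_mul _ hu, Matrix.mul_one]
  have h1 := den_num_herm M τ.1.toMatrix
  rw [← hnum, Matrix.conjTranspose_mul] at h1
  have h2 : (den M τ.1.toMatrix)ᴴ * ((M • τ).1.toMatrix - (M • τ).1.toMatrixᴴ) *
      den M τ.1.toMatrix = τ.1.toMatrix - τ.1.toMatrixᴴ := by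
    rw [Matrix.mul_sub, Matrix.sub_mul, Matrix.mul_assoc, h1]
    abel
  rw [sub_conjTranspose (M • τ).2.1, sub_conjTranspose τ.2.1, Matrix.mul_smul,
    Matrix.smul_mul] at h2
  exact smul_right_injective _ (mul_ne_zero two_ne_zero Complex.I_ne_zero) h2

theorem det_im_smul (M : Sp g) (τ : SiegelSpace g) :
    (τ.1.toMatrix.map Complex.im).det = ‖(den M τ.1.toMatrix).det‖ ^ 2 *
      ((M • τ).1.toMatrix.map Complex.im).det := by
  have hd : ∀ y : Matrix (Fin g) (Fin g) ℝ, (y.map Complex.ofReal).det = ((y.det : ℝ) : ℂ) :=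
    fun y => (RingHom.map_det Complex.ofRealHom y).symm
  have h := congrArg Matrix.det (im_smul M τ)
  rw [Matrix.det_mul, Matrix.det_mul, Matrix.det_conjTranspose, hd, hd, mul_right_comm,
    Complex.star_def, Complex.conj_mul'] at h
  exact_mod_cast h.symm

/-- The action of `Sp(2g, ℤ)` on `ℤ^{2g}`, in terms of pairs `(q, k)` where `k` has the first `g`
coordinates. -/
def latticeEquiv (M : Sp g) : (Fin g → ℤ) × (Fin g → ℤ) ≃ (Fin g → ℤ) × (Fin g → ℤ) where
  toFun v := ((M.val *ᵥ Sum.elim v.2 v.1) ∘ Sum.inr, (M.val *ᵥ Sum.elim v.2 v.1) ∘ Sum.inl)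
  invFun v := ((M⁻¹.val *ᵥ Sum.elim v.2 v.1) ∘ Sum.inr, (M⁻¹.val *ᵥ Sum.elim v.2 v.1) ∘ Sum.inl)
  left_inv v := by
    simp only [Sum.elim_comp_inl_inr, Matrix.mulVec_mulVec]
    rw [← Submonoid.coe_mul, inv_mul_cancel]
    simp
  right_inv v := by
    simp only [Sum.elim_comp_inl_inr, Matrix.mulVec_mulVec]
    rw [← Submonoid.coe_mul, mul_inv_cancel]
    simp

theorem latticeEquiv_apply (M : Sp g) (q k : Fin g → ℤ) :
    latticeEquiv M (q, k) = (M.val.toBlocks₂₁ *ᵥ k + M.val.toBlocks₂₂ *ᵥ q,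
      M.val.toBlocks₁₁ *ᵥ k + M.val.toBlocks₁₂ *ᵥ q) := by
  have h := Matrix.fromBlocks_mulVec M.val.toBlocks₁₁ M.val.toBlocks₁₂ M.val.toBlocks₂₁
    M.val.toBlocks₂₂ (Sum.elim k q)
  rw [Matrix.fromBlocks_toBlocks] at h
  simp only [latticeEquiv, Equiv.coe_fn_mk, h]
  rfl

theorem toC_intVec_add (A B : Matrix (Fin g) (Fin g) ℤ) (k q : Fin g → ℤ) :
    toC (intVec (A *ᵥ k + B *ᵥ q)) =
      A.map (Int.cast : ℤ → ℂ) *ᵥ toC (intVec k) + B.map (Int.cast : ℤ → ℂ) *ᵥ toC (intVec q) := by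
  ext i
  simp [intVec, Matrix.mulVec, dotProduct]

/-- `(c τ + d)ᵗ (k - (M τ) q) = k' - τ q'` for `(k, q) = M (k', q')`. -/
theorem den_transpose_mulVec (M : Sp g) (τ : SiegelSpace g) (q k : Fin g → ℤ) :
    (den M τ.1.toMatrix)ᵀ *ᵥ (toC (intVec (latticeEquiv M (q, k)).2) -
      (M • τ).1.toMatrix *ᵥ toC (intVec (latticeEquiv M (q, k)).1)) =
    toC (intVec k) - τ.1.toMatrix *ᵥ toC (intVec q) := by
  have hu := isUnit_den M τ.2
  -- By symmetry of `Mτ`, this is the transpose of `(Mτ)(cτ+d) = aτ+b`; what remains is the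
  -- symplectic relations.
  have hT : (den M τ.1.toMatrix)ᵀ * (M • τ).1.toMatrix = (num M τ.1.toMatrix)ᵀ := by
    have hs : (M • τ).1.toMatrixᵀ = (M • τ).1.toMatrix := (M • τ).2.1
    rw [← hs, ← Matrix.transpose_mul, coe_smul, Matrix.mul_assoc, Matrix.nonsing_inv_mul _ hu,
      Matrix.mul_one]
  obtain ⟨h1, h2, h3, h4⟩ := blocks_rel M
  have c1 := congrArg (fun A : Matrix (Fin g) (Fin g) ℤ => A.map (Int.castRingHom ℂ)) h1
  have c2 := congrArg (fun A : Matrix (Fin g) (Fin g) ℤ => A.map (Int.castRingHom ℂ)) h2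
  have c3 := congrArg (fun A : Matrix (Fin g) (Fin g) ℤ => A.map (Int.castRingHom ℂ)) h3
  have c4 := congrArg (fun A : Matrix (Fin g) (Fin g) ℤ => A.map (Int.castRingHom ℂ)) h4
  simp only [Matrix.map_mul, Matrix.transpose_map, Matrix.map_add _ (map_add _),
    Matrix.map_one _ (map_zero _) (map_one _)] at c1 c2 c3 c4
  simp only [Int.coe_castRingHom] at c1 c2 c3 c4
  have hs : τ.1.toMatrixᵀ = τ.1.toMatrix := τ.2.1
  rw [Matrix.mulVec_sub, Matrix.mulVec_mulVec, hT, latticeEquiv_apply, toC_intVec_add,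
    toC_intVec_add, den, num]
  simp only [Matrix.transpose_add, Matrix.transpose_mul, hs, ← Matrix.transpose_map,
    Matrix.mulVec_add, Matrix.mulVec_mulVec] at *
  generalize M.val.toBlocks₁₁ᵀ.map (Int.cast : ℤ → ℂ) = A' at *
  generalize M.val.toBlocks₁₂ᵀ.map (Int.cast : ℤ → ℂ) = B' at *
  generalize M.val.toBlocks₂₁ᵀ.map (Int.cast : ℤ → ℂ) = C' at *
  generalize M.val.toBlocks₂₂ᵀ.map (Int.cast : ℤ → ℂ) = D' at *
  generalize M.val.toBlocks₁₁.map (Int.cast : ℤ → ℂ) = A at *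
  generalize M.val.toBlocks₁₂.map (Int.cast : ℤ → ℂ) = B at *
  generalize M.val.toBlocks₂₁.map (Int.cast : ℤ → ℂ) = C at *
  generalize M.val.toBlocks₂₂.map (Int.cast : ℤ → ℂ) = D at *
  generalize τ.1.toMatrix = T
  have e1 : (T * C' + D') * A = (T * A' + B') * C + 1 := by
    rw [Matrix.add_mul, Matrix.add_mul, Matrix.mul_assoc, Matrix.mul_assoc, c1, c4]; abel
  have e2 : (T * A' + B') * D = (T * C' + D') * B + T := by
    rw [Matrix.add_mul, Matrix.add_mul, Matrix.mul_assoc, Matrix.mul_assoc, c2, c3]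
    noncomm_ring
  rw [e1, e2, Matrix.add_mulVec, Matrix.add_mulVec, Matrix.one_mulVec]
  abel

/-- With `w₀ = Dᵗ w` and `Y = Dᵗ Y' D̄`, where `D = cτ+d`, the Hermitian forms `w₀^* Y⁻¹ w₀` and
`w^* Y'⁻¹ w` agree: if `z` solves `Y' z = w`, then `z₀ = D̄⁻¹ z` solves `Y z₀ = w₀`. -/
theorem majorant_smul (M : Sp g) (τ : SiegelSpace g) (v : (Fin g → ℤ) × (Fin g → ℤ)) :
    majorant (M • τ).1.toMatrix (intVec (latticeEquiv M v).2) (intVec (latticeEquiv M v).1) =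
      majorant τ.1.toMatrix (intVec v.2) (intVec v.1) := by
  obtain ⟨q, k⟩ := v
  have hu := isUnit_den M τ.2
  have hw := den_transpose_mulVec M τ q k
  have hY := im_smul M τ
  set D := den M τ.1.toMatrix
  set w := toC (intVec (latticeEquiv M (q, k)).2) -
      (M • τ).1.toMatrix *ᵥ toC (intVec (latticeEquiv M (q, k)).1) with hw_def
  set w₀ := toC (intVec k) - τ.1.toMatrix *ᵥ toC (intVec q) with hw0_def
  set Y := (τ.1.toMatrix.map Complex.im).map Complex.ofReal with hY_def
  set Y' := ((M • τ).1.toMatrix.map Complex.im).map Complex.ofReal with hY'_def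
  have hY'u : IsUnit Y'.det := by
    have : Y'.det = _ := (RingHom.map_det Complex.ofRealHom
      ((M • τ).1.toMatrix.map Complex.im)).symm
    rw [this]
    exact (Complex.ofReal_ne_zero.mpr (M • τ).2.2.det_pos.ne').isUnit
  -- transposing `Dᴴ Y' D = Y`
  have hYt : Yᵀ = Y := by
    rw [hY_def, ← Matrix.transpose_map, ← Matrix.transpose_map]
    rw [show τ.1.toMatrixᵀ = τ.1.toMatrix from τ.2.1]
  have hYt' : Y'ᵀ = Y' := by
    rw [hY'_def, ← Matrix.transpose_map, ← Matrix.transpose_map]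
    rw [show (M • τ).1.toMatrixᵀ = (M • τ).1.toMatrix from (M • τ).2.1]
  have hY2 : Dᵀ * Y' * (Dᴴ)ᵀ = Y := by
    rw [← hYt, ← hY, Matrix.transpose_mul, Matrix.transpose_mul, hYt', Matrix.mul_assoc]
  have hDu : IsUnit (Dᴴ)ᵀ.det := by
    rw [Matrix.det_transpose, Matrix.det_conjTranspose]
    exact hu.star
  set z := Y'⁻¹ *ᵥ w with hz
  set z₀ := ((Dᴴ)ᵀ)⁻¹ *ᵥ z with hz0
  have hz1 : Y' *ᵥ z = w := by
    rw [hz, Matrix.mulVec_mulVec, Matrix.mul_nonsing_inv _ hY'u, Matrix.one_mulVec]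
  have hz2 : (Dᴴ)ᵀ *ᵥ z₀ = z := by
    rw [hz0, Matrix.mulVec_mulVec, Matrix.mul_nonsing_inv _ hDu, Matrix.one_mulVec]
  have hz3 : Y *ᵥ z₀ = w₀ := by
    rw [← hY2, ← Matrix.mulVec_mulVec, hz2, ← Matrix.mulVec_mulVec, hz1, hw]
  rw [← Complex.ofReal_inj, majorant_eq (M • τ).2.2 _ _ hz1, majorant_eq τ.2.2 _ _ hz3,
    ← hw_def, ← hw0_def, ← hw, Matrix.star_mulVec, ← Matrix.dotProduct_mulVec, ← hz2]
  rfl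

/-- `|Θ(M τ)|² = |det(c τ + d)| |Θ(τ)|²`. -/
theorem normSq_thetaNull_smul (M : Sp g) (τ : SiegelSpace g) :
    ‖thetaNull (M • τ).1‖ ^ 2 = ‖(den M τ.1.toMatrix).det‖ * ‖thetaNull τ.1‖ ^ 2 := by
  have hD : 0 < ‖(den M τ.1.toMatrix).det‖ := norm_pos_iff.mpr (isUnit_den M τ.2).ne_zero
  -- Reindexing the lattice by `M` makes the two Gaussian sums equal, so only the factors `(det
  -- y)^(-1/2)` differ.
  rw [(summable_exp_majorant_and_normSq (M • τ).2).2, (summable_exp_majorant_and_normSq τ.2).2,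
    ← (latticeEquiv M).tsum_eq, det_im_smul M τ, Real.sqrt_mul (by positivity),
    Real.sqrt_sq hD.le]
  simp only [majorant_smul]
  field_simp

end NormSq

/-! ### Holomorphy of the theta constants and of the symplectic action. -/

section Holomorphy

variable {g : ℕ}

theorem norm_entry_le (τ : SymMat g) (i j : Fin g) : ‖τ.toMatrix i j‖ ≤ ‖τ‖ :=
  (norm_le_pi_norm (τ.toMatrix i) j).trans (norm_le_pi_norm (fun i => τ.toMatrix i) i)

theorem toMatrix_sub (τ σ : SymMat g) : (τ - σ).toMatrix = τ.toMatrix - σ.toMatrix := rfl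

/-- The entries of a symmetric matrix, as a continuous linear map. -/
def entryCLM (i j : Fin g) : SymMat g →L[ℂ] ℂ :=
  LinearMap.mkContinuous
    { toFun := fun τ => τ.toMatrix i j
      map_add' := fun _ _ => rfl
      map_smul' := fun _ _ => rfl } 1 fun τ => (norm_entry_le τ i j).trans_eq (one_mul _).symm

@[simp] theorem entryCLM_apply (i j : Fin g) (τ : SymMat g) : entryCLM i j τ = τ.toMatrix i j := rfl

theorem exists_lower_bound_nhds {τ₀ : SymMat g} (h : τ₀ ∈ siegelSet g) :
    ∃ ε > 0, ∃ c > 0, ∀ τ ∈ Metric.ball τ₀ ε, ∀ v : Fin g → ℝ,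
      c * ∑ i, v i ^ 2 ≤ v ⬝ᵥ τ.toMatrix.map Complex.im *ᵥ v := by
  obtain ⟨c, hc, hcy⟩ := exists_lower_bound h.2
  -- Changing the entries by at most `ε` changes the form by at most `ε (∑ |v i|)² ≤ ε g ∑ (v i)²`,
  -- which costs at most half of `c`. Using `g + 1` covers `g = 0`.
  refine ⟨c / (2 * (g + 1)), by positivity, c / 2, by positivity, fun τ hτ v => ?_⟩
  set ε := c / (2 * (g + 1)) with hε
  have hd : ∀ i j, |(τ.toMatrix i j).im - (τ₀.toMatrix i j).im| ≤ ε := fun i j => by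
    rw [← Complex.sub_im, ← Matrix.sub_apply, ← toMatrix_sub]
    exact (Complex.abs_im_le_norm _).trans ((norm_entry_le _ i j).trans
      (by rw [← dist_eq_norm]; exact (Metric.mem_ball.mp hτ).le))
  have h1 : |v ⬝ᵥ τ.toMatrix.map Complex.im *ᵥ v - v ⬝ᵥ τ₀.toMatrix.map Complex.im *ᵥ v| ≤
      ε * (∑ i, |v i|) ^ 2 := by
    rw [sq, Finset.sum_mul_sum]
    simp only [dotProduct, Matrix.mulVec, Finset.mul_sum, ← Finset.sum_sub_distrib,
      Matrix.map_apply]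
    refine (Finset.abs_sum_le_sum_abs _ _).trans (Finset.sum_le_sum fun i _ => ?_)
    refine (Finset.abs_sum_le_sum_abs _ _).trans (Finset.sum_le_sum fun j _ => ?_)
    rw [show v i * ((τ.toMatrix i j).im * v j) - v i * ((τ₀.toMatrix i j).im * v j) =
      ((τ.toMatrix i j).im - (τ₀.toMatrix i j).im) * (v i * v j) by ring, abs_mul, abs_mul]
    exact mul_le_mul_of_nonneg_right (hd i j) (by positivity)
  have h2 : (∑ i, |v i|) ^ 2 ≤ g * ∑ i, v i ^ 2 := by
    have := sq_sum_le_card_mul_sum_sq (s := Finset.univ) (f := fun i => |v i|)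
    simpa using this
  have h3 : 0 ≤ ∑ i, v i ^ 2 := Finset.sum_nonneg fun _ _ => sq_nonneg _
  have h4 : ε * (∑ i, |v i|) ^ 2 ≤ c / 2 * ∑ i, v i ^ 2 := by
    calc ε * (∑ i, |v i|) ^ 2 ≤ ε * (g * ∑ i, v i ^ 2) := by gcongr
      _ ≤ ε * ((g + 1) * ∑ i, v i ^ 2) := by gcongr; linarith
      _ = c / 2 * ∑ i, v i ^ 2 := by rw [hε]; field_simp
  have h5 := (abs_le.mp h1).1
  have h6 := hcy v
  linarith

theorem isOpen_siegelSet (g : ℕ) : IsOpen (siegelSet g) := by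
  rw [Metric.isOpen_iff]
  intro τ₀ h
  obtain ⟨ε, hε, c, hc, hb⟩ := exists_lower_bound_nhds h
  refine ⟨ε, hε, fun τ hτ => ⟨τ.2, posDef_iff_real.mpr ⟨?_, fun x hx => ?_⟩⟩⟩
  · exact Matrix.IsSymm.map (A := τ.toMatrix) τ.2 _
  · refine lt_of_lt_of_le (mul_pos hc ?_) (hb τ hτ x)
    obtain ⟨i, hi⟩ := Function.ne_iff.mp hx
    exact Finset.sum_pos' (fun _ _ => sq_nonneg _) ⟨i, Finset.mem_univ i, by
      have : x i ≠ 0 := hi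
      positivity⟩

/-- The linear form `τ ↦ 2πi vᵗ τ v`. -/
def expForm (v : Fin g → ℝ) : SymMat g →L[ℂ] ℂ :=
  ∑ i, ∑ j, (2 * Real.pi * Complex.I * (v i * v j)) • entryCLM i j

theorem thetaTerm_eq_exp (v : Fin g → ℝ) (τ : SymMat g) :
    thetaTerm τ.toMatrix v = Complex.exp (expForm v τ) := by
  rw [thetaTerm]
  congr 1
  simp only [expForm, _root_.sum_apply, _root_.smul_apply, entryCLM_apply,
    smul_eq_mul, dotProduct, Matrix.mulVec, toC_apply, Finset.mul_sum]
  exact Finset.sum_congr rfl fun i _ => Finset.sum_congr rfl fun j _ => by ring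

theorem norm_expForm_le (v : Fin g → ℝ) : ‖expForm v‖ ≤ 2 * Real.pi * g ^ 2 * (1 + ‖v‖) ^ 2 := by
  refine (norm_sum_le _ _).trans ?_
  have h : ∀ i j : Fin g, ‖(2 * Real.pi * Complex.I * (v i * v j)) • entryCLM (g := g) i j‖ ≤
      2 * Real.pi * (1 + ‖v‖) ^ 2 := fun i j => by
    rw [norm_smul]
    have h1 : ‖entryCLM (g := g) i j‖ ≤ 1 := LinearMap.mkContinuous_norm_le _ zero_le_one _
    have h2 : ‖(2 * Real.pi * Complex.I * (v i * v j) : ℂ)‖ = 2 * Real.pi * (|v i| * |v j|) := by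
      simp [abs_of_pos Real.pi_pos]
    have h3 : ∀ i, |v i| ≤ 1 + ‖v‖ := fun i => by
      have := norm_le_pi_norm v i
      rw [Real.norm_eq_abs] at this
      linarith
    rw [h2, sq]
    calc 2 * Real.pi * (|v i| * |v j|) * ‖entryCLM (g := g) i j‖
        ≤ 2 * Real.pi * ((1 + ‖v‖) * (1 + ‖v‖)) * 1 := by
          gcongr <;> apply h3
      _ = _ := mul_one _
  calc ∑ i : Fin g, ‖∑ j : Fin g, (2 * Real.pi * Complex.I * (v i * v j)) • entryCLM (g := g) i j‖
      ≤ ∑ _i : Fin g, ∑ _j : Fin g, 2 * Real.pi * (1 + ‖v‖) ^ 2 :=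
        Finset.sum_le_sum fun i _ => (norm_sum_le _ _).trans (Finset.sum_le_sum fun j _ => h i j)
    _ = _ := by simp; ring

/-- The theta series with characteristic `u` and vector valued coefficients `a`. -/
def thetaSeries {F : Type} [NormedAddCommGroup F] [NormedSpace ℂ F] (u : Fin g → ℝ)
    (a : (Fin g → ℤ) → F) (τ : SymMat g) : F :=
  ∑' m : Fin g → ℤ, Complex.exp (expForm (fun i => (m i : ℝ) + u i) τ) • a m

theorem norm_exp_expForm_le {τ : SymMat g} {c : ℝ} {v : Fin g → ℝ}
    (h : c * ∑ i, v i ^ 2 ≤ v ⬝ᵥ τ.toMatrix.map Complex.im *ᵥ v) :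
    ‖Complex.exp (expForm v τ)‖ ≤ Real.exp (-(2 * Real.pi * c) * ∑ i, v i ^ 2) := by
  rw [← thetaTerm_eq_exp, norm_thetaTerm, Real.exp_le_exp]
  nlinarith [Real.pi_pos]

theorem summable_one_add_pow_mul_exp_neg {c : ℝ} (hc : 0 < c) (u : Fin g → ℝ) (k : ℕ) :
    Summable fun m : Fin g → ℤ => (1 + ‖fun i => (m i : ℝ) + u i‖) ^ k *
      Real.exp (-c * ∑ i, ((m i : ℝ) + u i) ^ 2) := by
  refine Summable.of_nonneg_of_le (fun _ => by positivity) (fun m => ?_)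
    (((summable_pow_mul_exp_neg hc u 0).add (summable_pow_mul_exp_neg hc u k)).mul_left
      (2 ^ (k - 1)))
  have h := add_pow_le zero_le_one (norm_nonneg fun i => (m i : ℝ) + u i) k
  rw [one_pow] at h
  calc _ ≤ 2 ^ (k - 1) * (1 + ‖fun i => (m i : ℝ) + u i‖ ^ k) *
        Real.exp (-c * ∑ i, ((m i : ℝ) + u i) ^ 2) := by gcongr
    _ = _ := by ring

/-- Termwise differentiation, justified by a Gaussian bound uniform on a ball. The derivative is
again a theta series, whose coefficients are linear maps growing with exponent `k + 2`, because
`expForm` is quadratic in the summation vector. -/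
theorem hasFDerivAt_thetaSeries {F : Type} [NormedAddCommGroup F] [NormedSpace ℂ F]
    [CompleteSpace F] (u : Fin g → ℝ) (a : (Fin g → ℤ) → F) {C : ℝ} {k : ℕ}
    (ha : ∀ m, ‖a m‖ ≤ C * (1 + ‖fun i => (m i : ℝ) + u i‖) ^ k) {τ₀ : SymMat g}
    (hτ₀ : τ₀ ∈ siegelSet g) :
    HasFDerivAt (thetaSeries u a)
      (thetaSeries u (fun m => (expForm fun i => (m i : ℝ) + u i).smulRight (a m)) τ₀) τ₀ := by
  obtain ⟨ε, hε, c, hc, hb⟩ := exists_lower_bound_nhds hτ₀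
  have hmem : τ₀ ∈ Metric.ball τ₀ ε := Metric.mem_ball_self hε
  have hc' : 0 < 2 * Real.pi * c := by positivity
  refine hasFDerivAt_tsum_of_isPreconnected (𝕜 := ℂ)
    (f := fun m τ => Complex.exp (expForm (fun i => (m i : ℝ) + u i) τ) • a m)
    (f' := fun m τ => Complex.exp (expForm (fun i => (m i : ℝ) + u i) τ) •
      (expForm fun i => (m i : ℝ) + u i).smulRight (a m))
    ((summable_one_add_pow_mul_exp_neg hc' u (k + 2)).mul_left (2 * Real.pi * g ^ 2 * C))
    Metric.isOpen_ball (convex_ball τ₀ ε).isPreconnected (fun m τ _ => ?_) (fun m τ hτ => ?_)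
    hmem ?_ hmem
  · have h := ((expForm fun i => (m i : ℝ) + u i).hasFDerivAt (x := τ)).cexp.smul_const (a m)
    refine h.congr_fderiv ?_
    ext σ
    simp [mul_smul]
  · rw [norm_smul, ContinuousLinearMap.norm_smulRight_apply]
    calc _ ≤ Real.exp (-(2 * Real.pi * c) * ∑ i, ((m i : ℝ) + u i) ^ 2) *
          ((2 * Real.pi * g ^ 2 * (1 + ‖fun i => (m i : ℝ) + u i‖) ^ 2) *
            (C * (1 + ‖fun i => (m i : ℝ) + u i‖) ^ k)) := by
          gcongr
          · exact norm_exp_expForm_le (hb τ hτ _)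
          · exact norm_expForm_le _
          · exact ha m
      _ = _ := by ring
  · refine Summable.of_norm_bounded
      ((summable_one_add_pow_mul_exp_neg hc' u k).mul_left C) fun m => ?_
    rw [norm_smul]
    calc _ ≤ Real.exp (-(2 * Real.pi * c) * ∑ i, ((m i : ℝ) + u i) ^ 2) *
          (C * (1 + ‖fun i => (m i : ℝ) + u i‖) ^ k) := by
          gcongr
          · exact norm_exp_expForm_le (hb τ₀ hmem _)
          · exact ha m
      _ = _ := by ring

/-- The space `F` and the coefficients are quantified inside the induction, since each derivative
replaces `F` by the linear maps into `F`. -/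
theorem contDiffOn_thetaSeries (u : Fin g → ℝ) (n : ℕ) :
    ∀ {F : Type} [NormedAddCommGroup F] [NormedSpace ℂ F] [CompleteSpace F]
      (a : (Fin g → ℤ) → F) {C : ℝ} {k : ℕ}
      (_ : ∀ m, ‖a m‖ ≤ C * (1 + ‖fun i => (m i : ℝ) + u i‖) ^ k),
      ContDiffOn ℂ n (thetaSeries u a) (siegelSet g) := by
  induction n with
  | zero =>
    intro F _ _ _ a C k ha
    exact contDiffOn_zero.mpr fun τ hτ =>
      (hasFDerivAt_thetaSeries u a ha hτ).continuousAt.continuousWithinAt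
  | succ n ih =>
    intro F _ _ _ a C k ha
    have hcast : ((n + 1 : ℕ) : ℕ∞ω) = (n : ℕ∞ω) + 1 := by push_cast; rfl
    rw [hcast, contDiffOn_succ_iff_fderiv_of_isOpen (isOpen_siegelSet g)]
    refine ⟨fun τ hτ => (hasFDerivAt_thetaSeries u a ha hτ).differentiableAt.differentiableWithinAt,
      fun h => absurd h (by simp), ?_⟩
    refine (ih (fun m => (expForm fun i => (m i : ℝ) + u i).smulRight (a m))
      (C := 2 * Real.pi * g ^ 2 * C) (k := k + 2) fun m => ?_).congr fun τ hτ =>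
        (hasFDerivAt_thetaSeries u a ha hτ).fderiv
    rw [ContinuousLinearMap.norm_smulRight_apply]
    calc _ ≤ (2 * Real.pi * g ^ 2 * (1 + ‖fun i => (m i : ℝ) + u i‖) ^ 2) *
            (C * (1 + ‖fun i => (m i : ℝ) + u i‖) ^ k) := by
          gcongr
          · exact norm_expForm_le _
          · exact ha m
      _ = _ := by ring

theorem contDiffAt_thetaNull {τ : SymMat g} (hτ : τ ∈ siegelSet g) :
    ContDiffAt ℂ ∞ (thetaNull (g := g)) τ := by
  refine contDiffAt_euclidean.mpr fun α => ?_
  have h : (fun τ : SymMat g => thetaNull τ α) = thetaSeries (halfRep α) fun _ => (1 : ℂ) := by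
    funext τ
    refine (secondOrderTheta_zero _ _).trans (tsum_congr fun m => ?_)
    rw [thetaTerm_eq_exp, smul_eq_mul, mul_one]
  rw [h]
  refine (contDiffOn_infty.mpr fun n => contDiffOn_thetaSeries (halfRep α) n _ (C := 1) (k := 0)
    fun m => ?_).contDiffAt ((isOpen_siegelSet g).mem_nhds hτ)
  simp

/-! ### The action is holomorphic -/

theorem contDiffAt_det {E : Type*} [NormedAddCommGroup E] [NormedSpace ℂ E] {n : ℕ∞ω}
    {A : E → Matrix (Fin g) (Fin g) ℂ} {x : E} (h : ∀ i j, ContDiffAt ℂ n (fun y => A y i j) x) :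
    ContDiffAt ℂ n (fun y => (A y).det) x := by
  simp only [Matrix.det_apply]
  exact ContDiffAt.sum fun σ _ => (contDiffAt_prod fun i _ => h _ _).const_smul _

theorem contDiffAt_adjugate {E : Type*} [NormedAddCommGroup E] [NormedSpace ℂ E] {n : ℕ∞ω}
    {A : E → Matrix (Fin g) (Fin g) ℂ} {x : E} (h : ∀ i j, ContDiffAt ℂ n (fun y => A y i j) x)
    (i j : Fin g) : ContDiffAt ℂ n (fun y => (A y).adjugate i j) x := by
  simp only [Matrix.adjugate_apply]
  refine contDiffAt_det fun k l => ?_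
  by_cases hk : k = j
  · subst hk
    simpa using contDiffAt_const
  · simpa [Matrix.updateRow_apply, hk] using h k l

theorem contDiffAt_affine (A B : Matrix (Fin g) (Fin g) ℂ) (τ : SymMat g) (i j : Fin g) :
    ContDiffAt ℂ ∞ (fun σ : SymMat g => (A * σ.toMatrix + B) i j) τ := by
  simp only [Matrix.add_apply, Matrix.mul_apply]
  exact (ContDiffAt.sum fun k _ => contDiffAt_const.mul
    (entryCLM k j).contDiff.contDiffAt).add contDiffAt_const

theorem contDiffAt_det_den (M : Sp g) (τ : SymMat g) :
    ContDiffAt ℂ ∞ (fun σ : SymMat g => (den M σ.toMatrix).det) τ :=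
  contDiffAt_det fun _ _ => contDiffAt_affine _ _ _ _ _

theorem contDiffAt_symMat {E : Type*} [NormedAddCommGroup E] [NormedSpace ℂ E] {n : ℕ∞ω}
    {f : E → SymMat g} {x : E} (h : ∀ i j, ContDiffAt ℂ n (fun y => (f y).toMatrix i j) x) :
    ContDiffAt ℂ n f x := by
  let e : SymMat g →ₗ[ℂ] (Fin g → Fin g → ℂ) :=
    { toFun := fun τ i j => τ.toMatrix i j
      map_add' := fun _ _ => rfl
      map_smul' := fun _ _ => rfl }
  have he : LinearMap.ker e = ⊥ := LinearMap.ker_eq_bot.mpr fun τ σ hτσ => Subtype.ext hτσ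
  -- A linear left inverse of the inclusion into all matrices is continuous in finite dimension, so
  -- smoothness may be checked on entries.
  obtain ⟨r, hr⟩ := e.exists_leftInverse_of_injective he
  have hf : f = fun y => r.toContinuousLinearMap (fun i j => (f y).toMatrix i j) := by
    funext y
    exact (LinearMap.congr_fun hr (f y)).symm
  rw [hf]
  exact r.toContinuousLinearMap.contDiff.contDiffAt.comp x
    (contDiffAt_pi.mpr fun i => contDiffAt_pi.mpr fun j => h i j)

theorem actMap_eq (M : Sp g) {τ : SymMat g} (hτ : τ ∈ siegelSet g) :
    actMap M τ = (M • (⟨τ, hτ⟩ : SiegelSpace g)).1 := dif_pos hτ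

theorem contDiffAt_actMap (M : Sp g) {τ : SymMat g} (hτ : τ ∈ siegelSet g) :
    ContDiffAt ℂ ∞ (actMap M) τ := by
  refine contDiffAt_symMat fun i j => ?_
  -- Cramer's rule: the entries of `Mτ` are polynomials in those of `τ` divided by `det(cτ+d)`.
  have hev : (fun σ => (actMap M σ).toMatrix i j) =ᶠ[nhds τ] fun σ =>
      ∑ k, num M σ.toMatrix i k *
        ((den M σ.toMatrix).det⁻¹ * (den M σ.toMatrix).adjugate k j) := by
    filter_upwards [(isOpen_siegelSet g).mem_nhds hτ] with σ hσ
    rw [actMap_eq M hσ, coe_smul, Matrix.inv_def, Matrix.mul_apply]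
    simp [Ring.inverse_eq_inv']
  refine ContDiffAt.congr_of_eventuallyEq ?_ hev
  exact ContDiffAt.sum fun k _ => (contDiffAt_affine _ _ _ _ _).mul
    (((contDiffAt_det_den M τ).inv (isUnit_den M hτ).ne_zero).mul
      (contDiffAt_adjugate (fun _ _ => contDiffAt_affine _ _ _ _ _) k j))

end Holomorphy

/-! ### Invariance of the pulled back form and descent to the quotient. -/

section Descent

variable {g : ℕ}

theorem two_le_infty : (2 : ℕ∞ω) ≤ ∞ :=
  WithTop.coe_le_coe.mpr (le_top : (2 : ℕ∞) ≤ ⊤)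

/-- The pullback of the Fubini–Study form by the second order theta constants. -/
def thetaForm (g : ℕ) (τ : SiegelSpace g) : TwoForm (SymMat g) :=
  pullback thetaNull (fubiniStudy (Fin g → ZMod 2)) τ.1

theorem isHomogeneousLift_thetaNull (h : ∀ τ : SiegelSpace g, thetaNull τ.1 ≠ 0) :
    IsHomogeneousLift (thetaMap h) (siegelSet g) thetaNull where
  isOpen := isOpen_siegelSet g
  subset := subset_rfl
  differentiableOn := fun _ hτ =>
    ((contDiffAt_thetaNull hτ).differentiableAt (by simp)).differentiableWithinAt
  lift := fun τ _ => ⟨h τ, rfl⟩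

theorem isFubiniStudyPullback_thetaForm (h : ∀ τ : SiegelSpace g, thetaNull τ.1 ≠ 0) :
    IsFubiniStudyPullback (thetaMap h) (thetaForm g) := by
  refine ⟨fun x => ⟨siegelSet g, thetaNull, x.2, isHomogeneousLift_thetaNull h⟩,
    fun W F hF x hx => ?_⟩
  -- Any other lift is pointwise proportional to `thetaNull`. The factor `c` is merely chosen, and
  -- `pullback_fubiniStudy_congr_smul` asks nothing more of it than being nonzero at `x`.
  have hprop : ∀ y ∈ W, ∃ a : ℂ, F y = a • thetaNull y := fun y hy => by
    obtain ⟨hne, hyF⟩ := hF.lift ⟨y, hF.subset hy⟩ hy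
    obtain ⟨a, ha⟩ := (Projectivization.mk_eq_mk_iff' ℂ _ _ hne (h ⟨y, hF.subset hy⟩)).mp hyF.symm
    exact ⟨a, ha.symm⟩
  choose! c hc using hprop
  obtain ⟨hne, -⟩ := hF.lift x hx
  refine (pullback_fubiniStudy_congr_smul (c := c)
    ((contDiffAt_thetaNull x.2).differentiableAt (by simp))
    ((hF.differentiableOn x hx).differentiableAt (hF.isOpen.mem_nhds hx)) (h x) ?_ ?_).symm
  · intro h0
    exact hne (by rw [hc _ hx, h0, zero_smul])
  · filter_upwards [hF.isOpen.mem_nhds hx] with y hy using hc y hy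

/-- By the chain rule the left side is the form of the lift `thetaNull ∘ actMap M`, whose squared
norm is that of `thetaNull` times `|det(cτ+d)|`. -/
theorem actPullback_thetaForm (M : Sp g) : actPullback M (thetaForm g) = thetaForm g := by
  funext τ
  have hact : actMap M τ.1 = (M • τ).1 := actMap_eq M τ.2
  have hA := contDiffAt_actMap M τ.2
  have hΘ := contDiffAt_thetaNull τ.2
  have hΘM : ContDiffAt ℂ ∞ (thetaNull (g := g)) (actMap M τ.1) := by
    rw [hact]; exact contDiffAt_thetaNull (M • τ).2
  have hG : ContDiffAt ℂ ∞ (thetaNull ∘ actMap M) τ.1 := hΘM.comp τ.1 hA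
  have hD : fderiv ℂ (thetaNull ∘ actMap M) τ.1 =
      (fderiv ℂ thetaNull (M • τ).1).comp (fderiv ℂ (actMap M) τ.1) := by
    rw [fderiv_comp _ (hΘM.differentiableAt (by simp)) (hA.differentiableAt (by simp)), hact]
  have h2 := two_le_infty
  refine twoForm_ext fun v w => ?_
  have hkey := fsValue_eq_of_normSq_eq (hΘ.of_le h2) (hG.of_le h2)
    ((contDiffAt_det_den M τ.1).of_le h2) (thetaNull_ne_zero τ.2)
    (by rw [Function.comp_apply, hact]; exact thetaNull_ne_zero (M • τ).2)
    (isUnit_den M τ.2).ne_zero ?_ v w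
  · rw [thetaForm, pullback_fubiniStudy_apply (thetaNull_ne_zero τ.2), ← hkey, hD,
      Function.comp_apply, hact, ContinuousLinearMap.comp_apply, ContinuousLinearMap.comp_apply,
      ← pullback_fubiniStudy_apply (thetaNull_ne_zero (M • τ).2), actPullback,
      ContinuousAlternatingMap.compContinuousLinearMap_apply]
    change pullback thetaNull _ (M • τ).1 _ = _
    congr 1
    ext i
    fin_cases i <;> rfl
  · filter_upwards [(isOpen_siegelSet g).mem_nhds τ.2] with σ hσ
    rw [Function.comp_apply, actMap_eq M hσ]
    exact normSq_thetaNull_smul M ⟨σ, hσ⟩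

theorem isSmoothForm_thetaForm : IsSmoothForm (thetaForm g) := by
  intro τ hτ
  have h : ContDiffAt ℝ ∞ (fun σ => (Complex.I / 2) •
      deldelbar (fun y : SymMat g => ((Real.log (‖thetaNull y‖ ^ 2) : ℝ) : ℂ)) σ) τ :=
    (contDiffAt_deldelbar (contDiffAt_log_normSq (contDiffAt_thetaNull hτ)
      (thetaNull_ne_zero hτ))).const_smul _
  refine (h.congr_of_eventuallyEq ?_).contDiffWithinAt
  filter_upwards [(isOpen_siegelSet g).mem_nhds hτ] with σ hσ
  rw [dif_pos hσ]
  exact pullback_fubiniStudy_eq_deldelbar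
    ((contDiffAt_thetaNull hσ).of_le two_le_infty) (thetaNull_ne_zero hσ)

/-- The differential of `thetaNull` is complex linear, so the type is inherited from the
Fubini–Study form. -/
theorem isOneOne_thetaForm : IsOneOne (thetaForm g) := fun τ v w => by
  rw [thetaForm, pullback_fubiniStudy_apply (thetaNull_ne_zero τ.2),
    pullback_fubiniStudy_apply (thetaNull_ne_zero τ.2), map_smul, map_smul, fsValue_I_smul]

theorem AgForm.ext_of_pullback {η₁ η₂ : AgForm g} (h : η₁.pullback = η₂.pullback) : η₁ = η₂ := by
  have hf : η₁.toFun = η₂.toFun := by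
    funext x τ hτ
    subst hτ
    exact congrFun h τ
  cases η₁
  cases η₂
  cases hf
  rfl

/-- The form on `A_g` whose pullback to the Siegel space is `thetaForm`. -/
def thetaAgForm (g : ℕ) : AgForm g where
  toFun _ τ _ := thetaForm g τ
  -- Compatibility of the family along an orbit is exactly invariance of the form.
  compatible _ τ _ M := congrFun (actPullback_thetaForm M) τ
  smooth := isSmoothForm_thetaForm
  oneOne := isOneOne_thetaForm

end Descent

end ThetaFS

end

open ThetaFS
/-- The second order theta constants have no common zero on `ℍ_g`, and the pullback
`Ω = Θ^* ω_FS` by the resulting map `Θ : ℍ_g → ℙ^{2^g-1}` is invariant under `Sp(2g, ℤ)` and is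
the pullback of a unique smooth `(1, 1)`-form on `A_g`. -/
theorem proposition3p3 (g : ℕ) :
    ∃ h : ∀ τ : SiegelSpace g, thetaNull τ.1 ≠ 0,
      ∃ Ω : SiegelSpace g → TwoForm (SymMat g),
        IsFubiniStudyPullback (thetaMap h) Ω ∧
        (∀ M : Sp g, actPullback M Ω = Ω) ∧
        ∃! η : AgForm g, η.pullback = Ω :=
  ⟨fun τ => thetaNull_ne_zero τ.2, thetaForm g, isFubiniStudyPullback_thetaForm _,
    actPullback_thetaForm, thetaAgForm g, rfl, fun _ hη => AgForm.ext_of_pullback hη⟩
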